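/- Let $k\ge 3$ and let $n_1,\dots,n_k$, $r$ be integers with $1\le r\le\min\{n_1,\dots,n_k\}$. For $m\le n$ let $V(m,n)=\{U\in\mathbb R^{n\times m}: U^{\mathsf T}U=I\}$. For $\mathcal A\in\mathbb R^{n_1}\otimes\dots\otimes\mathbb R^{n_k}$ and a tuple of matrices $\mathbb U=(U^{(1)},\dots,U^{(k)})$, $U^{(i)}\in\mathbb R^{n_i\times r}$ with columns $\mathbf u^{(i)}_1,\dots,\mathbf u^{(i)}_r$, put for $1\le i\le k$, $1\le j\le r$ $$\lambda_j(\mathbb U)=\langle\mathcal A,\mathbf u^{(1)}_j\otimes\dots\otimes\mathbf u^{(k)}_j\rangle,\qquad \lambda(\mathbb U)=(\lambda_1(\mathbb U),\dots,\lambda_r(\mathbb U)),\qquad \Lambda=\operatorname{diag}(\lambda_1(\mathbb U),\dots,\lambda_r(\mathbb U)),$$ and let $V^{(i)}\in\mathbb R^{n_i\times r}$ be the matrix whose $j$-th column is the contraction of $\mathcal A$ with $\mathbf u^{(l)}_j$ in every mode $l\ne i$. Consider the problem mLROTA($r$) of maximizing $f(\mathbb U)=\sum_{j=1}^r\lambda_j(\mathbb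 U)^2$ over $\mathbb U\in V(r,n_1)\times\dots\times V(r,n_k)$. A feasible $\mathbb U$ is a KKT point if there are symmetric matrices $P_1,\dots,P_k\in\mathbb R^{r\times r}$ with $V^{(i)}\Lambda=U^{(i)}P_i$ for all $i$; it is a regular KKT point if moreover $\operatorname{rank}(V^{(i)}\Lambda)\ge\min\{r,n_i-1\}$ for all $i$. Let $$g(\mathbb U,\mathbf x)=\tfrac12\bigl\|\mathcal A-\sum_{j=1}^r x_j\,\mathbf u^{(1)}_j\otimes\dots\otimes\mathbf u^{(k)}_j\bigr\|^2$$ on the manifold $U_{\mathbf n,r}=V(r,n_1)\times\dots\times V(r,n_k)\times(\mathbb R\setminus\{0\})^r$, with $\|\cdot\|$ the Hilbert-Schmidt norm. A point of $U_{\mathbf n,r}$ is a nondegenerate critical point of $g$ if, in local coordinates of $U_{\mathbf n,r}$ around it, the differential of $g$ vanishes and the Hessian matrix of $g$ is nonsingular. **Theorem 5.3 (Regular KKT point).** For a generic tensor $\mathcal A$, that is, for every $\mathcal A$ outside the zero set of some nonzero polynomial in the tensor entries (which depends only on $n_1,\dots,n_k$ and $r$), the following holds. If $\mathbb U$ is a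 local maximizer of mLROTA($r$) with $\lambda_j(\mathbb U)\ne0$ for all $1\le j\le r$, then $(\mathbb U,\lambda(\mathbb U))$ is a nondegenerate critical point of $g$ on $U_{\mathbf n,r}$, and $\mathbb U$ is a regular KKT point of mLROTA($r$). -/

import Mathlib

open scoped BigOperators ContDiff Matrix.Norms.Elementwise

namespace LROTA

/-! ## Tensors -/

/-- The space `ℝ^{n_1} ⊗ ⋯ ⊗ ℝ^{n_k}` of real tensors of format `n_1 × ⋯ × n_k`, in coordinates. -/
abbrev Tensor {k : ℕ} (n : Fin k → ℕ) : Type := (∀ i, Fin (n i)) → ℝ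

/-- Tuples `(U^{(1)}, …, U^{(k)})` with `U^{(i)}` a real `n_i × r` matrix. -/
abbrev Factors {k : ℕ} (n : Fin k → ℕ) (r : ℕ) : Type := ∀ i, Matrix (Fin (n i)) (Fin r) ℝ

/-- A property holds for a generic tensor: it holds for every tensor outside the zero set of
some nonzero polynomial in the entries, that is, outside a proper real algebraic subset. -/
def Generic {k : ℕ} {n : Fin k → ℕ} (Q : Tensor n → Prop) : Prop :=
  ∃ p : MvPolynomial (∀ i, Fin (n i)) ℝ, p ≠ 0 ∧
    ∀ A : Tensor n, MvPolynomial.eval A p ≠ 0 → Q A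

/-- The Hilbert-Schmidt inner product of two tensors. -/
def hsInner {k : ℕ} {n : Fin k → ℕ} (A B : Tensor n) : ℝ := ∑ I, A I * B I

/-- The Hilbert-Schmidt norm of a tensor. -/
noncomputable def hsNorm {k : ℕ} {n : Fin k → ℕ} (A : Tensor n) : ℝ := √(hsInner A A)

/-- The diagonal tensor `diag(x_1, …, x_r)` of order `k`. -/
def diagTensor (k : ℕ) {r : ℕ} (x : Fin r → ℝ) : Tensor (fun _ : Fin k => r) :=
  fun J => ∑ j, if ∀ i, J i = j then x j else 0

/-- The diagonal `Diag(T)` of an `r × ⋯ × r` tensor. -/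
def tensorDiag {k r : ℕ} (T : Tensor (fun _ : Fin k => r)) : Fin r → ℝ :=
  fun j => T (fun _ => j)

/-- The matrix-tensor product `(B^{(1)}, …, B^{(k)}) · A`. -/
def matTensor {k : ℕ} {m n : Fin k → ℕ} (B : ∀ i, Matrix (Fin (m i)) (Fin (n i)) ℝ)
    (A : Tensor n) : Tensor m :=
  fun I => ∑ J, (∏ i, B i (I i) (J i)) * A J

/-- The rank-one tensor `τ(x) = x_1 ⊗ ⋯ ⊗ x_k`. -/
def segre {k : ℕ} {n : Fin k → ℕ} (x : ∀ i, Fin (n i) → ℝ) : Tensor n :=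
  fun I => ∏ i, x i (I i)

/-- The vector `A τ_i(x) ∈ ℝ^{n_i}`: contraction of `A` with `x_j` in every mode `j ≠ i`. -/
def contractExcept {k : ℕ} {n : Fin k → ℕ} (A : Tensor n) (x : ∀ i, Fin (n i) → ℝ) (i : Fin k) :
    Fin (n i) → ℝ :=
  fun a => ∑ I : (∀ l, Fin (n l)),
    if I i = a then A I * ∏ l ∈ Finset.univ.erase i, x l (I l) else 0

/-- The defining relation `⟨A τ_i(x), x_i⟩ = ⟨A, τ(x)⟩`. -/
theorem contractExcept_dotProduct {k : ℕ} {n : Fin k → ℕ} (A : Tensor n)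
    (x : ∀ i, Fin (n i) → ℝ) (i : Fin k) :
    contractExcept A x i ⬝ᵥ x i = hsInner A (segre x) := by
  simp only [contractExcept, dotProduct, hsInner, segre, Finset.sum_mul]
  rw [Finset.sum_comm]
  refine Finset.sum_congr rfl fun I _ => ?_
  simp only [ite_mul, zero_mul, Finset.sum_ite_eq, Finset.mem_univ, if_true]
  rw [← Finset.mul_prod_erase Finset.univ (fun l => x l (I l)) (Finset.mem_univ i)]
  ring

/-- The block vector `x_j = (u^{(1)}_j, …, u^{(k)}_j)` of `j`-th columns. -/
def blockCol {k : ℕ} {n : Fin k → ℕ} {r : ℕ} (U : Factors n r) (j : Fin r) :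
    ∀ i, Fin (n i) → ℝ :=
  fun i a => U i a j

/-! ## The optimization problem -/

/-- The product of Stiefel manifolds `V(r, n_1) × ⋯ × V(r, n_k)`. -/
def stiefelProd {k : ℕ} (n : Fin k → ℕ) (r : ℕ) : Set (Factors n r) :=
  {U | ∀ i, (U i).transpose * U i = 1}

/-- `λ(U) = Diag(((U^{(1)})ᵀ, …, (U^{(k)})ᵀ) · A)`, the vector of the diagonal values. -/
def diagValues {k : ℕ} {n : Fin k → ℕ} {r : ℕ} (A : Tensor n) (U : Factors n r) : Fin r → ℝ :=
  tensorDiag (matTensor (m := fun _ => r) (fun i => (U i).transpose) A)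

/-- The diagonal values are `λ_j(U) = ⟨A, τ(x_j)⟩`. -/
theorem diagValues_eq {k : ℕ} {n : Fin k → ℕ} {r : ℕ} (A : Tensor n) (U : Factors n r)
    (j : Fin r) : diagValues A U j = hsInner A (segre (blockCol U j)) := by
  simp [diagValues, tensorDiag, matTensor, hsInner, segre, blockCol, mul_comm]

/-- The objective function `f(U) = ∑_j λ_j(U)^2` of the maximization problem. -/
def objective {k : ℕ} {n : Fin k → ℕ} {r : ℕ} (A : Tensor n) (U : Factors n r) : ℝ :=
  ∑ j, diagValues A U j ^ 2

/-- `U` is a local maximizer of `f` over the product of the Stiefel manifolds. -/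
def IsLocalMaximizer {k : ℕ} {n : Fin k → ℕ} {r : ℕ} (A : Tensor n) (U : Factors n r) : Prop :=
  U ∈ stiefelProd n r ∧ IsLocalMaxOn (objective A) (stiefelProd n r) U

/-- The matrix `V^{(i)}`, whose `j`-th column is `A τ_i(x_j)`. -/
def matV {k : ℕ} {n : Fin k → ℕ} {r : ℕ} (A : Tensor n) (U : Factors n r) (i : Fin k) :
    Matrix (Fin (n i)) (Fin r) ℝ :=
  Matrix.of fun a j => contractExcept A (blockCol U j) i a

/-- The diagonal matrix `Λ = diag(λ_1(U), …, λ_r(U))`. -/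
def matLambda {k : ℕ} {n : Fin k → ℕ} {r : ℕ} (A : Tensor n) (U : Factors n r) :
    Matrix (Fin r) (Fin r) ℝ :=
  Matrix.diagonal (diagValues A U)

/-- KKT points of the maximization problem. -/
def IsKKTPoint {k : ℕ} {n : Fin k → ℕ} {r : ℕ} (A : Tensor n) (U : Factors n r) : Prop :=
  U ∈ stiefelProd n r ∧ ∃ P : Fin k → Matrix (Fin r) (Fin r) ℝ,
    ∀ i, (P i).IsSymm ∧ matV A U i * matLambda A U - U i * P i = 0

/-- Regular KKT points: `V^{(i)} Λ` has rank at least `min {r, n_i - 1}` for every `i`. -/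
def IsRegularKKTPoint {k : ℕ} {n : Fin k → ℕ} {r : ℕ} (A : Tensor n) (U : Factors n r) : Prop :=
  IsKKTPoint A U ∧ ∀ i, min r (n i - 1) ≤ (matV A U i * matLambda A U).rank

/-! ## The parametrized problem and nondegenerate critical points -/

/-- The manifold `U_{n,r} = V(r, n_1) × ⋯ × V(r, n_k) × (ℝ ∖ {0})^r`. -/
def paramManifold {k : ℕ} (n : Fin k → ℕ) (r : ℕ) : Set (Factors n r × (Fin r → ℝ)) :=
  {z | z.1 ∈ stiefelProd n r ∧ ∀ j, z.2 j ≠ 0}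

/-- `g(U, x) = ½ ‖A - (U^{(1)}, …, U^{(k)}) · diag(x)‖²`. -/
noncomputable def paramObjective {k : ℕ} {n : Fin k → ℕ} {r : ℕ} (A : Tensor n)
    (z : Factors n r × (Fin r → ℝ)) : ℝ :=
  1 / 2 * hsNorm (A - matTensor (n := fun _ => r) z.1 (diagTensor k z.2)) ^ 2

/-- `ψ`, restricted to the open set `W ⊆ ℝ^d`, is a local parametrization (inverse of a chart)
of the embedded submanifold `M ⊆ E` around its point `ψ w`: a smooth immersion that is a
homeomorphism from `W` onto a relatively open subset of `M`. -/
structure IsLocalParametrization {E : Type*} [NormedAddCommGroup E] [NormedSpace ℝ E]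
    (M : Set E) {d : ℕ} (W : Set (Fin d → ℝ)) (ψ : (Fin d → ℝ) → E) : Prop where
  isOpen_source : IsOpen W
  smooth : ContDiffOn ℝ ∞ ψ W
  immersion : ∀ w ∈ W, Function.Injective (fderiv ℝ ψ w)
  embedding : Topology.IsEmbedding (fun w : W => ψ w)
  image_eq : ∃ O : Set E, IsOpen O ∧ ψ '' W = M ∩ O

/-- The Hessian matrix of `h : ℝ^d → ℝ` at `w`. -/
noncomputable def hessianMatrix {d : ℕ} (h : (Fin d → ℝ) → ℝ) (w : Fin d → ℝ) :
    Matrix (Fin d) (Fin d) ℝ :=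
  Matrix.of fun a b => iteratedFDeriv ℝ 2 h w ![Pi.single a 1, Pi.single b 1]

/-- `z` is a nondegenerate critical point of the (smooth) function `f` on the embedded submanifold
`M ⊆ E`: in local coordinates around `z`, the differential of `f` vanishes and the Hessian matrix of
`f` is nonsingular. By the chain rule this does not depend on the local coordinates. -/
def IsNondegenerateCriticalPoint {E : Type*} [NormedAddCommGroup E] [NormedSpace ℝ E]
    (M : Set E) (f : E → ℝ) (z : E) : Prop :=
  ∃ (d : ℕ) (W : Set (Fin d → ℝ)) (ψ : (Fin d → ℝ) → E) (w : Fin d → ℝ),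
    IsLocalParametrization M W ψ ∧ w ∈ W ∧ ψ w = z ∧
      fderiv ℝ (f ∘ ψ) w = 0 ∧ (hessianMatrix (f ∘ ψ) w).det ≠ 0

end LROTA

open LROTA

namespace LROTA

/-! For U in the product of Stiefel manifolds the rank-one tensors τ(x_j) are orthonormal, so
completing the square gives g(U, x) = ½‖A‖² − ½ f(U) + ½ ∑ (x_j − λ_j(U))²
(`paramObjective_of_mem`). A local maximizer U of f with all λ_j(U) ≠ 0 thus yields a local
minimizer (U, λ(U)) of g on the parameter manifold, hence a critical point.

Its nondegeneracy is a dimension count (`exists_polynomial_of_minor`). In a Cayley chart g is ½‖A −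
φ(θ)‖² with φ rational, and φ is an immersion where the weights are nonzero because k ≥ 3
(`eq_zero_of_differential_eq_zero`). For fixed θ the critical equations are linear in A and have
rank dim θ, so the critical pairs (θ, A) are rationally parametrized by a space of the same
dimension as the tensor space. Degeneracy of the Hessian is one further equation on them. It is not
an identity, because at A = φ(θ) the Hessian is a Gram matrix of independent vectors. The degenerate
A therefore lie in the rational image of a proper hypersurface, and transcendence degree supplies a
nonzero polynomial vanishing there (`exists_relation_of_trdeg_le`). Finitely many charts, indexed by
signs, cover the manifold, and their polynomials are multiplied.

Regularity follows from nondegeneracy. A nondegenerate local minimizer is isolated in its level set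
(`IsNondegenerateCriticalPoint.eventually_ne`). If the rank of V⁽ⁱ⁾Λ were too small, there would be
a plane, not orthogonal to the column space of U⁽ⁱ⁾, whose rotations change no λ_j; rotating U⁽ⁱ⁾ in
it would give a curve of points with the same value of g. -/

/-! ## Images of hypersurfaces -/

/-- In a domain of transcendence degree at most `#τ`, the values of a family `F` indexed by `τ` at
the zeros of a nonzero element `E` satisfy a nontrivial polynomial relation. -/
theorem exists_relation_of_trdeg_le {K L τ : Type} [Field K] [CommRing L] [IsDomain L]
    [Algebra K L] [Fintype τ] (h : Algebra.trdeg K L ≤ Fintype.card τ) {E : L} (hE : E ≠ 0)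
    (F : τ → L) :
    ∃ G : MvPolynomial τ K, G ≠ 0 ∧
      ∀ ev : L →ₐ[K] K, ev E = 0 → MvPolynomial.eval (fun i => ev (F i)) G = 0 := by
  classical
  -- Adjoining E to the family gives one element more than the transcendence degree allows.
  have hdep : ¬ AlgebraicIndependent K (fun o : Option τ => o.elim E F) := by
    intro hi
    have h1 := hi.cardinalMk_le_trdeg.trans h
    rw [Cardinal.mk_fintype, Fintype.card_option] at h1
    have h2 : Fintype.card τ + 1 ≤ Fintype.card τ := by exact_mod_cast h1
    omega
  rw [algebraicIndependent_iff_injective_aeval, injective_iff_map_eq_zero] at hdep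
  push Not at hdep
  obtain ⟨R, hR0, hRne⟩ := hdep
  set R' := MvPolynomial.optionEquivLeft K τ R with hR'
  have hR'ne : R' ≠ 0 := by simpa [hR'] using hRne
  -- Regard the relation as a polynomial in the variable of E and remove the highest power of that
  -- variable. Since E ≠ 0 in a domain, the quotient is still a relation, and its constant
  -- coefficient is now nonzero.
  obtain ⟨Q, hQ, hnd⟩ := Polynomial.exists_eq_pow_rootMultiplicity_mul_and_not_dvd R' hR'ne 0
  have hQev : Polynomial.eval₂ (MvPolynomial.aeval F).toRingHom E Q = 0 := by
    have h1 : Polynomial.eval₂ (MvPolynomial.aeval F).toRingHom E R' = 0 := by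
      rw [← hR0, hR']
      have : (Polynomial.eval₂RingHom (MvPolynomial.aeval F).toRingHom E).comp
          ((MvPolynomial.optionEquivLeft K τ).toAlgHom.toRingHom) =
          (MvPolynomial.aeval (fun o : Option τ => o.elim E F)).toRingHom := by
        apply MvPolynomial.ringHom_ext
        · intro c
          simp [MvPolynomial.optionEquivLeft_C]
        · intro o
          cases o <;> simp
      exact congrArg (fun g => g R) this
    rw [hQ, Polynomial.eval₂_mul] at h1
    rcases mul_eq_zero.1 h1 with h2 | h2
    · simp [Polynomial.eval₂_pow] at h2
      exact absurd h2.1 hE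
    · exact h2
  refine ⟨Q.coeff 0, ?_, ?_⟩
  · intro h0
    apply hnd
    rw [Polynomial.C_0, sub_zero]
    exact Polynomial.X_dvd_iff.2 h0
  -- Where E vanishes, only the constant coefficient of the relation survives.
  · intro ev hev
    have h1 := congrArg ev hQev
    rw [map_zero, ← AlgHom.coe_toRingHom, Polynomial.hom_eval₂] at h1
    simp only [AlgHom.coe_toRingHom, hev] at h1
    rw [Polynomial.eval₂_at_zero] at h1
    rw [← h1, ← MvPolynomial.coe_aeval_eq_eval]
    simp only [RingHom.coe_comp, Function.comp, RingHom.coe_coe, AlgHom.toRingHom_eq_coe]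
    rw [← AlgHom.comp_apply, MvPolynomial.comp_aeval]

/-- Inverting Q is an injective algebraic extension, so the variables remain a transcendence basis.
-/
theorem trdeg_localization_away {σ : Type} [Fintype σ] {Q : MvPolynomial σ ℝ} (hQ : Q ≠ 0) :
    Algebra.trdeg ℝ (Localization.Away Q) = Fintype.card σ := by
  have hle : Submonoid.powers Q ≤ nonZeroDivisors (MvPolynomial σ ℝ) :=
    powers_le_nonZeroDivisors_of_noZeroDivisors hQ
  have : IsDomain (Localization.Away Q) := IsLocalization.isDomain_localization hle
  have : Algebra.IsAlgebraic (MvPolynomial σ ℝ) (Localization.Away Q) :=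
    IsLocalization.isAlgebraic _ (Submonoid.powers Q)
  have : FaithfulSMul (MvPolynomial σ ℝ) (Localization.Away Q) :=
    (faithfulSMul_iff_algebraMap_injective _ _).2 (IsLocalization.injective _ hle)
  have h1 : IsTranscendenceBasis ℝ (MvPolynomial.X (R := ℝ) : σ → MvPolynomial σ ℝ) :=
    IsTranscendenceBasis.mvPolynomial σ ℝ
  have h2 := h1.algebraMap_comp (A := Localization.Away Q)
  rw [← h2.cardinalMk_eq_trdeg, Cardinal.mk_fintype]

/-! ## Regular functions -/

/-- A function on `ℝ^σ` that is a quotient of polynomials with a nowhere vanishing denominator. -/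
def IsRegularFun {σ : Type} (f : (σ → ℝ) → ℝ) : Prop :=
  ∃ p q : MvPolynomial σ ℝ, (∀ x, MvPolynomial.eval x q ≠ 0) ∧
    ∀ x, f x = MvPolynomial.eval x p / MvPolynomial.eval x q

namespace IsRegularFun

variable {σ τ : Type} {f g : (σ → ℝ) → ℝ}

theorem const (c : ℝ) : IsRegularFun fun _ : σ → ℝ => c :=
  ⟨MvPolynomial.C c, 1, by simp, by simp⟩

theorem coord (i : σ) : IsRegularFun fun x : σ → ℝ => x i :=
  ⟨MvPolynomial.X i, 1, by simp, by simp⟩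

theorem add (hf : IsRegularFun f) (hg : IsRegularFun g) : IsRegularFun fun x => f x + g x := by
  obtain ⟨p, q, hq, h⟩ := hf
  obtain ⟨p', q', hq', h'⟩ := hg
  refine ⟨p * q' + q * p', q * q', fun x => by simp [hq, hq'], fun x => ?_⟩
  simp only [h, h', div_add_div _ _ (hq x) (hq' x), map_add, map_mul]

theorem mul (hf : IsRegularFun f) (hg : IsRegularFun g) : IsRegularFun fun x => f x * g x := by
  obtain ⟨p, q, hq, h⟩ := hf
  obtain ⟨p', q', hq', h'⟩ := hg
  refine ⟨p * p', q * q', fun x => by simp [hq, hq'], fun x => ?_⟩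
  simp only [h, h', div_mul_div_comm, map_mul]

theorem inv (hf : IsRegularFun f) (h0 : ∀ x, f x ≠ 0) : IsRegularFun fun x => (f x)⁻¹ := by
  obtain ⟨p, q, hq, h⟩ := hf
  refine ⟨q, p, fun x hx => h0 x (by rw [h, hx, zero_div]), fun x => ?_⟩
  simp only [h, inv_div]

theorem neg (hf : IsRegularFun f) : IsRegularFun fun x => -f x := by
  simpa using (const (-1)).mul hf

theorem sub (hf : IsRegularFun f) (hg : IsRegularFun g) : IsRegularFun fun x => f x - g x := by
  simpa [sub_eq_add_neg] using hf.add hg.neg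

theorem sum {ι : Type*} (s : Finset ι) {F : ι → (σ → ℝ) → ℝ} (h : ∀ i ∈ s, IsRegularFun (F i)) :
    IsRegularFun fun x => ∑ i ∈ s, F i x := by
  classical
  induction s using Finset.induction_on with
  | empty => simpa using const (σ := σ) 0
  | insert a s ha ih =>
    simp only [Finset.sum_insert ha]
    exact (h a (by simp)).add (ih fun i hi => h i (by simp [hi]))

theorem prod {ι : Type*} (s : Finset ι) {F : ι → (σ → ℝ) → ℝ} (h : ∀ i ∈ s, IsRegularFun (F i)) :
    IsRegularFun fun x => ∏ i ∈ s, F i x := by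
  classical
  induction s using Finset.induction_on with
  | empty => simpa using const (σ := σ) 1
  | insert a s ha ih =>
    simp only [Finset.prod_insert ha]
    exact (h a (by simp)).mul (ih fun i hi => h i (by simp [hi]))

theorem det {ι : Type*} [Fintype ι] [DecidableEq ι] {F : (σ → ℝ) → Matrix ι ι ℝ}
    (h : ∀ a b, IsRegularFun fun x => F x a b) : IsRegularFun fun x => (F x).det := by
  simp only [Matrix.det_apply']
  exact sum _ fun p _ => (const _).mul (prod _ fun i _ => h _ _)

theorem adjugate {ι : Type*} [Fintype ι] [DecidableEq ι] {F : (σ → ℝ) → Matrix ι ι ℝ}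
    (h : ∀ a b, IsRegularFun fun x => F x a b) (a b : ι) :
    IsRegularFun fun x => (F x).adjugate a b := by
  simp only [Matrix.adjugate_apply]
  refine det fun c d => ?_
  simp only [Matrix.updateRow_apply]
  split_ifs
  · exact const _
  · exact h _ _

theorem matrix_inv {ι : Type*} [Fintype ι] [DecidableEq ι] {F : (σ → ℝ) → Matrix ι ι ℝ}
    (h : ∀ a b, IsRegularFun fun x => F x a b) (h0 : ∀ x, (F x).det ≠ 0) (a b : ι) :
    IsRegularFun fun x => (F x)⁻¹ a b := by
  simp only [Matrix.inv_def, Ring.inverse_eq_inv', Matrix.smul_apply, smul_eq_mul]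
  exact ((det h).inv h0).mul (adjugate h a b)

theorem comp_map (hf : IsRegularFun f) (e : σ → τ) : IsRegularFun fun z : τ → ℝ => f (z ∘ e) := by
  obtain ⟨p, q, hq, h⟩ := hf
  refine ⟨MvPolynomial.rename e p, MvPolynomial.rename e q, fun z => ?_, fun z => ?_⟩
  · simpa [MvPolynomial.eval_rename] using hq _
  · simp [MvPolynomial.eval_rename, h]

end IsRegularFun

theorem contDiff_eval {σ : Type} [Fintype σ] (p : MvPolynomial σ ℝ) :
    ContDiff ℝ ∞ fun x : σ → ℝ => MvPolynomial.eval x p :=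
  (AnalyticOnNhd.eval_mvPolynomial p).contDiff

theorem IsRegularFun.contDiff {σ : Type} [Fintype σ] {f : (σ → ℝ) → ℝ} (hf : IsRegularFun f) :
    ContDiff ℝ ∞ f := by
  obtain ⟨p, q, hq, h⟩ := hf
  rw [funext h]
  exact (contDiff_eval p).div (contDiff_eval q) hq

/-- The partial derivative of a function on `ℝ^σ` in the direction of a coordinate. -/
noncomputable def partialDeriv {σ : Type} [Fintype σ] [DecidableEq σ] (a : σ)
    (f : (σ → ℝ) → ℝ) : (σ → ℝ) → ℝ :=
  fun x => fderiv ℝ f x (Pi.single a 1)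

theorem partialDeriv_eval {σ : Type} [Fintype σ] [DecidableEq σ] (a : σ) (p : MvPolynomial σ ℝ) :
    partialDeriv a (fun x => MvPolynomial.eval x p) =
      fun x => MvPolynomial.eval x (MvPolynomial.pderiv a p) := by
  have hd : ∀ (p : MvPolynomial σ ℝ) x,
      DifferentiableAt ℝ (fun x : σ → ℝ => MvPolynomial.eval x p) x := fun p x =>
    ((contDiff_eval p).differentiable (by simp)).differentiableAt
  funext x
  unfold partialDeriv
  induction p using MvPolynomial.induction_on with
  | C c => simp
  | add p q hp hq =>
    simp only [map_add, ← hp, ← hq]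
    rw [fderiv_fun_add (hd p x) (hd q x)]
    rfl
  | mul_X p i hp =>
    have h2 : HasFDerivAt (fun x : σ → ℝ => x i) (ContinuousLinearMap.proj (R := ℝ) i) x :=
      hasFDerivAt_apply i x
    simp only [map_mul, MvPolynomial.eval_X]
    rw [((hd p x).hasFDerivAt.fun_mul h2).fderiv]
    simp only [Derivation.leibniz, MvPolynomial.pderiv_X, smul_eq_mul, map_add, map_mul,
      MvPolynomial.eval_X, ← hp, add_apply, smul_apply, ContinuousLinearMap.proj_apply]
    by_cases h : i = a
    · subst h; simp
    · simp [h]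

theorem IsRegularFun.partialDeriv {σ : Type} [Fintype σ] [DecidableEq σ] {f : (σ → ℝ) → ℝ}
    (hf : IsRegularFun f) (a : σ) : IsRegularFun (partialDeriv a f) := by
  obtain ⟨p, q, hq, h⟩ := hf
  have hd : ∀ (p : MvPolynomial σ ℝ) x,
      DifferentiableAt ℝ (fun x : σ → ℝ => MvPolynomial.eval x p) x := fun p x =>
    ((contDiff_eval p).differentiable (by simp)).differentiableAt
  have hf : Differentiable ℝ f := IsRegularFun.contDiff ⟨p, q, hq, h⟩ |>.differentiable (by simp)
  refine ⟨MvPolynomial.pderiv a p * q - p * MvPolynomial.pderiv a q, q * q,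
    fun x => by simp [hq], fun x => ?_⟩
  have e1 := congrFun (partialDeriv_eval a p) x
  have e2 := congrFun (partialDeriv_eval a q) x
  have hqx := hq x
  -- The quotient rule is obtained by differentiating the product p = f q and solving for the
  -- derivative of f.
  have hfq : (fun x => MvPolynomial.eval x p) = fun x => f x * MvPolynomial.eval x q :=
    funext fun y => by rw [h, div_mul_cancel₀ _ (hq y)]
  unfold LROTA.partialDeriv at *
  rw [hfq, fderiv_fun_mul (hf x) (hd q x)] at e1
  simp only [add_apply, smul_apply, smul_eq_mul, e2] at e1
  simp only [map_sub, map_mul, ← e1]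
  rw [eq_div_iff (by simp [hqx]), h x]
  field_simp
  ring

/-- The image of a hypersurface under a rational map between affine spaces of equal dimension lies
in a hypersurface. -/
theorem exists_polynomial_vanishing_on_image {σ τ : Type} [Fintype σ] [Fintype τ]
    (hcard : Fintype.card σ ≤ Fintype.card τ) {m E : (σ → ℝ) → ℝ} {c : τ → (σ → ℝ) → ℝ}
    (hm : IsRegularFun m) (hE : IsRegularFun E) (hc : ∀ i, IsRegularFun (c i))
    (hne : ∃ z, m z ≠ 0 ∧ E z ≠ 0) :
    ∃ G : MvPolynomial τ ℝ, G ≠ 0 ∧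
      ∀ z, m z ≠ 0 → E z = 0 → MvPolynomial.eval (fun i => c i z / m z) G = 0 := by
  classical
  obtain ⟨pm, qm, hqm, hm⟩ := hm
  obtain ⟨pE, qE, hqE, hE⟩ := hE
  choose p q hq hc using hc
  -- As a fraction, c i / m is (p i * qm) / (q i * pm). Inverting Q makes all these denominators
  -- units at once, and Q vanishes at no z with m z ≠ 0.
  set Q : MvPolynomial σ ℝ := pm * ∏ i, q i with hQdef
  have hQev : ∀ z, m z ≠ 0 → MvPolynomial.eval z Q ≠ 0 := by
    intro z hz
    rw [hQdef, map_mul, map_prod]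
    refine mul_ne_zero (fun h => hz (by rw [hm, h, zero_div])) ?_
    exact Finset.prod_ne_zero_iff.2 fun i _ => hq i z
  obtain ⟨z0, hz0, hEz0⟩ := hne
  have hQ0 : Q ≠ 0 := fun h => hQev z0 hz0 (by rw [h, map_zero])
  have hle : Submonoid.powers Q ≤ nonZeroDivisors (MvPolynomial σ ℝ) :=
    powers_le_nonZeroDivisors_of_noZeroDivisors hQ0
  have : IsDomain (Localization.Away Q) := IsLocalization.isDomain_localization hle
  have hunit : ∀ i, IsUnit (algebraMap (MvPolynomial σ ℝ) (Localization.Away Q) (q i * pm)) := by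
    intro i
    refine isUnit_of_dvd_unit (map_dvd _ ?_) (IsLocalization.Away.algebraMap_isUnit Q)
    rw [hQdef, mul_comm]
    exact mul_dvd_mul_left _ (Finset.dvd_prod_of_mem _ (Finset.mem_univ i))
  have hE0 : algebraMap (MvPolynomial σ ℝ) (Localization.Away Q) pE ≠ 0 := by
    intro h
    rw [IsLocalization.to_map_eq_zero_iff _ hle] at h
    exact hEz0 (by rw [hE, h, map_zero, zero_div])
  obtain ⟨G, hG0, hG⟩ := exists_relation_of_trdeg_le (K := ℝ) (L := Localization.Away Q) (τ := τ)
    (by rw [trdeg_localization_away hQ0]; exact_mod_cast hcard) hE0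
    (fun i => algebraMap (MvPolynomial σ ℝ) (Localization.Away Q) (p i * qm) *
      ((hunit i).unit⁻¹ : (Localization.Away Q)ˣ))
  refine ⟨G, hG0, fun z hz hEz => ?_⟩
  have hpE : MvPolynomial.eval z pE = 0 := by
    have := hE z
    rw [hEz, eq_comm, div_eq_zero_iff] at this
    exact this.resolve_right (hqE z)
  have hpow : ∀ y : Submonoid.powers Q, IsUnit (MvPolynomial.aeval (R := ℝ) z (y : MvPolynomial σ ℝ)) := by
    rintro ⟨_, n, rfl⟩
    rw [map_pow]
    exact (IsUnit.mk0 _ (hQev z hz)).pow n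
  -- Evaluation at z extends to the localization because Q does not vanish at z.
  let ev : Localization.Away Q →ₐ[ℝ] ℝ := IsLocalization.liftAlgHom (M := Submonoid.powers Q)
    (f := MvPolynomial.aeval (R := ℝ) z) hpow
  have hev : ∀ s, ev (algebraMap _ _ s) = MvPolynomial.eval z s := fun s => by
    simp [ev]
  have := hG ev (by rw [hev, hpE])
  suffices h : ∀ i, c i z / m z = _ from (congrArg (fun v => MvPolynomial.eval v G) (funext h)).trans this
  intro i
  have h1 : ev ((hunit i).unit⁻¹ : (Localization.Away Q)ˣ) * MvPolynomial.eval z (q i * pm) = 1 := by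
    rw [← hev, ← map_mul]
    simp
  rw [map_mul, hev, hc, hm]
  have hpm : MvPolynomial.eval z pm ≠ 0 := fun h => hz (by rw [hm, h, zero_div])
  have hqi := hq i z
  have hqmz := hqm z
  rw [eq_div_of_mul_eq (by simp [hqi, hpm]) h1]
  simp only [map_mul]
  field_simp

/-! ## Generic nondegeneracy of the distance to a rationally parametrized set -/

section SquaredDistance

variable {ι τ : Type} [Fintype ι] [DecidableEq ι] [Fintype τ]

/-- The differential of `½ ‖A - φ‖²` vanishes at `θ`. -/
def IsCriticalParam (φ : τ → (ι → ℝ) → ℝ) (A : τ → ℝ) (θ : ι → ℝ) : Prop :=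
  ∀ a, ∑ I, partialDeriv a (φ I) θ * (A I - φ I θ) = 0

/-- The Hessian matrix of `½ ‖A - φ‖²`. -/
noncomputable def sqDistHessian (φ : τ → (ι → ℝ) → ℝ) (A : τ → ℝ) (θ : ι → ℝ) : Matrix ι ι ℝ :=
  Matrix.of fun a b => ∑ I, (partialDeriv a (φ I) θ * partialDeriv b (φ I) θ -
    (A I - φ I θ) * partialDeriv a (partialDeriv b (φ I)) θ)

/-- The square submatrix of the Jacobian matrix with the columns selected by `S`. -/
noncomputable def jacobianMinor (φ : τ → (ι → ℝ) → ℝ) (S : ι → τ) (θ : ι → ℝ) : Matrix ι ι ℝ :=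
  Matrix.of fun a b => partialDeriv a (φ (S b)) θ

/-- This is Cramer's rule. The critical equations are linear in A; with the entries outside S moved
to the right, the adjugate of the minor solves for the entries in S. Where the minor is nonzero, θ
and the entries of A outside S thus determine A. -/
theorem minor_mul_sub_eq {φ : τ → (ι → ℝ) → ℝ} {A : τ → ℝ} {θ : ι → ℝ} (S : ι ↪ τ)
    [DecidablePred (· ∈ Set.range S)] (h : IsCriticalParam φ A θ) (b : ι) :
    (jacobianMinor φ S θ).det * (A (S b) - φ (S b) θ) =
      ∑ a, (jacobianMinor φ S θ).adjugate b a *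
        -∑ I : {I // I ∉ Set.range S}, partialDeriv a (φ I) θ * (A I - φ I θ) := by
  classical
  have h1 : ∀ a, (jacobianMinor φ S θ).mulVec (fun b => A (S b) - φ (S b) θ) a =
      -∑ I : {I // I ∉ Set.range S}, partialDeriv a (φ I) θ * (A I - φ I θ) := by
    intro a
    have h2 := h a
    rw [← Fintype.sum_subtype_add_sum_subtype (· ∈ Set.range S)
      (fun I => partialDeriv a (φ I) θ * (A I - φ I θ))] at h2
    rw [eq_neg_iff_add_eq_zero, ← h2]
    refine congrArg (· + _) ?_
    simp only [Matrix.mulVec, dotProduct, jacobianMinor, Matrix.of_apply]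
    convert Fintype.sum_equiv (Equiv.ofInjective S S.injective)
      (fun b => partialDeriv a (φ (S b)) θ * (A (S b) - φ (S b) θ))
      (fun I : {I // I ∈ Set.range S} => partialDeriv a (φ I) θ * (A I - φ I θ)) fun b => rfl
  simp only [← h1]
  change _ = (Matrix.mulVec _ _) b
  rw [Matrix.mulVec_mulVec, Matrix.adjugate_mul, Matrix.smul_mulVec, Matrix.one_mulVec]
  rfl

/-- When the target is φ(θ) itself the residual vanishes, and the Hessian is the Gram matrix of the
rows of the Jacobian matrix. Its quadratic form is a sum of squares, whose vanishing at v forces v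
to annihilate the nonsingular minor. -/
theorem sqDistHessian_self_det_ne_zero {φ : τ → (ι → ℝ) → ℝ} {θ : ι → ℝ} {S : ι → τ}
    (hS : (jacobianMinor φ S θ).det ≠ 0) : (sqDistHessian φ (fun I => φ I θ) θ).det ≠ 0 := by
  classical
  intro h0
  obtain ⟨v, hv, hv0⟩ := Matrix.exists_mulVec_eq_zero_iff.2 h0
  apply hv
  have h1 : ∑ I, (∑ a, v a * partialDeriv a (φ I) θ) ^ 2 = 0 := by
    have h2 : v ⬝ᵥ (sqDistHessian φ (fun I => φ I θ) θ).mulVec v = 0 := by rw [hv0]; simp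
    rw [← h2]
    simp only [dotProduct, Matrix.mulVec, sqDistHessian, Matrix.of_apply, sub_self, zero_mul,
      sub_zero, sq, Finset.mul_sum, Finset.sum_mul]
    rw [Finset.sum_comm]
    refine Finset.sum_congr rfl fun a _ => ?_
    rw [Finset.sum_comm]
    refine Finset.sum_congr rfl fun b _ => Finset.sum_congr rfl fun I _ => ?_
    ring
  rw [Finset.sum_eq_zero_iff_of_nonneg fun I _ => sq_nonneg _] at h1
  have h3 : Matrix.vecMul v (jacobianMinor φ S θ) = 0 := by
    funext b
    exact pow_eq_zero_iff (two_ne_zero) |>.1 (h1 (S b) (Finset.mem_univ _))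
  exact Matrix.eq_zero_of_vecMul_eq_zero hS h3

/-- Critical pairs with nonzero minor S are parametrized by θ and the entries of A outside S, which
are #τ parameters in total. In them the Hessian determinant is rational and not identically zero, so
`exists_polynomial_vanishing_on_image` applies to its zero set. -/
theorem exists_polynomial_of_minor [DecidableEq τ] {φ : τ → (ι → ℝ) → ℝ}
    (hφ : ∀ I, IsRegularFun (φ I)) (S : ι ↪ τ) :
    ∃ G : MvPolynomial τ ℝ, G ≠ 0 ∧ ∀ A θ, IsCriticalParam φ A θ →
      (jacobianMinor φ S θ).det ≠ 0 → (sqDistHessian φ A θ).det = 0 →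
        MvPolynomial.eval A G = 0 := by
  classical
  by_cases hS : ∃ θ₀, (jacobianMinor φ S θ₀).det ≠ 0
  swap
  · push Not at hS
    exact ⟨1, one_ne_zero, fun A θ _ h => absurd (hS θ) h⟩
  obtain ⟨θ₀, hθ₀⟩ := hS
  let σ := ι ⊕ {I // I ∉ Set.range S}
  let pr : (σ → ℝ) → (ι → ℝ) := fun z => z ∘ Sum.inl
  let m : (σ → ℝ) → ℝ := fun z => (jacobianMinor φ S (pr z)).det
  -- The solved entry A I multiplied by the minor m, so that no division occurs; `h.choose` is the
  -- index b with S b = I.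
  let c : τ → (σ → ℝ) → ℝ := fun I z =>
    if h : I ∈ Set.range S then
      ∑ a, (jacobianMinor φ S (pr z)).adjugate h.choose a *
        -∑ I' : {I // I ∉ Set.range S}, partialDeriv a (φ I') (pr z) *
          (z (Sum.inr I') - φ I' (pr z)) + m z * φ I (pr z)
    else m z * z (Sum.inr ⟨I, h⟩)
  -- The determinant of the Hessian with every entry scaled by m, expressed through c = m A.
  let E : (σ → ℝ) → ℝ := fun z => (Matrix.of fun a b => ∑ I,
    (m z * (partialDeriv a (φ I) (pr z) * partialDeriv b (φ I) (pr z)) -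
      (c I z - m z * φ I (pr z)) * partialDeriv a (partialDeriv b (φ I)) (pr z)) :
        Matrix ι ι ℝ).det
  have hJ : ∀ a b, IsRegularFun fun z : σ → ℝ => jacobianMinor φ S (pr z) a b := fun a b =>
    ((hφ _).partialDeriv a).comp_map Sum.inl
  have hm : IsRegularFun m := IsRegularFun.det hJ
  have hφz : ∀ I, IsRegularFun fun z : σ → ℝ => φ I (pr z) := fun I => (hφ I).comp_map Sum.inl
  have hφ1 : ∀ a I, IsRegularFun fun z : σ → ℝ => partialDeriv a (φ I) (pr z) := fun a I =>
    ((hφ I).partialDeriv a).comp_map Sum.inl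
  have hφ2 : ∀ a b I, IsRegularFun fun z : σ → ℝ => partialDeriv a (partialDeriv b (φ I)) (pr z) :=
    fun a b I => (((hφ I).partialDeriv b).partialDeriv a).comp_map Sum.inl
  have hc : ∀ I, IsRegularFun (c I) := by
    intro I
    by_cases h : I ∈ Set.range S
    · simp only [c, dif_pos h]
      refine (IsRegularFun.sum _ fun a _ => (IsRegularFun.adjugate hJ _ _).mul
        (IsRegularFun.neg (IsRegularFun.sum _ fun I' _ => ?_))).add (hm.mul (hφz I))
      exact (hφ1 a I').mul ((IsRegularFun.coord _).sub (hφz I'))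
    · simp only [c, dif_neg h]
      exact hm.mul (IsRegularFun.coord _)
  have hE : IsRegularFun E := IsRegularFun.det fun a b => IsRegularFun.sum _ fun I _ =>
    (hm.mul ((hφ1 a I).mul (hφ1 b I))).sub (((hc I).sub (hm.mul (hφz I))).mul (hφ2 a b I))
  let pt : (τ → ℝ) → (ι → ℝ) → (σ → ℝ) := fun A θ => Sum.elim θ fun I => A I
  have hcA : ∀ A θ, IsCriticalParam φ A θ → ∀ I, c I (pt A θ) = m (pt A θ) * A I := by
    intro A θ hcr I
    by_cases h : I ∈ Set.range S
    · have h1 := minor_mul_sub_eq S hcr h.choose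
      rw [h.choose_spec] at h1
      simp only [c, dif_pos h]
      have h2 : m (pt A θ) * (A I - φ I θ) + m (pt A θ) * φ I θ = m (pt A θ) * A I := by ring
      rw [← h2]
      exact congrArg (· + m (pt A θ) * φ I θ) h1.symm
    · simp only [c, dif_neg h, pt, Sum.elim_inr]
  have hEA : ∀ A θ, IsCriticalParam φ A θ →
      E (pt A θ) = m (pt A θ) ^ Fintype.card ι * (sqDistHessian φ A θ).det := by
    intro A θ hcr
    rw [← Matrix.det_smul]
    simp only [E]
    congr 1
    ext a b
    simp only [Matrix.of_apply, Matrix.smul_apply, sqDistHessian, smul_eq_mul, Finset.mul_sum]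
    refine Finset.sum_congr rfl fun I _ => ?_
    rw [hcA A θ hcr I]
    have : pr (pt A θ) = θ := rfl
    rw [this]
    ring
  have hcard : Fintype.card σ ≤ Fintype.card τ := by
    have h1 : Fintype.card {I // I ∈ Set.range S} = Fintype.card ι :=
      (Fintype.card_congr (Equiv.ofInjective S S.injective)).symm
    have h2 := Fintype.card_subtype_compl (fun I => I ∈ Set.range S)
    have h3 := Fintype.card_subtype_le (fun I => I ∈ Set.range S)
    simp only [σ, Fintype.card_sum]
    omega
  -- The pair with target φ(θ₀) is critical for trivial reasons and shows that E is not identically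
  -- zero.
  have hEne : E (pt (fun I => φ I θ₀) θ₀) ≠ 0 := by
    rw [hEA (fun I => φ I θ₀) θ₀ (fun a => by simp)]
    exact mul_ne_zero (pow_ne_zero _ hθ₀) (sqDistHessian_self_det_ne_zero hθ₀)
  obtain ⟨G, hG0, hG⟩ := exists_polynomial_vanishing_on_image hcard hm hE hc
    ⟨pt (fun I => φ I θ₀) θ₀, hθ₀, hEne⟩
  refine ⟨G, hG0, fun A θ hcr hne hdeg => ?_⟩
  have h1 := hG (pt A θ) hne (by rw [hEA A θ hcr, hdeg, mul_zero])
  have hmne : m (pt A θ) ≠ 0 := hne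
  have h2 : (fun i => c i (pt A θ) / m (pt A θ)) = A := by
    funext I
    rw [hcA A θ hcr I, mul_div_cancel_left₀ _ hmne]
  rwa [h2] at h1

omit [Fintype τ] in
/-- If the rows of the Jacobian matrix are linearly independent, some maximal minor is nonzero. -/
theorem exists_jacobianMinor_ne_zero {φ : τ → (ι → ℝ) → ℝ} {θ : ι → ℝ}
    (h : ∀ v : ι → ℝ, (∀ I, ∑ a, v a * partialDeriv a (φ I) θ = 0) → v = 0) :
    ∃ S : ι ↪ τ, (jacobianMinor φ S θ).det ≠ 0 := by
  classical
  let col : τ → ι → ℝ := fun I a => partialDeriv a (φ I) θ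
  -- If the columns did not span, a nonzero functional vanishing on all of them would be a linear
  -- relation between the rows.
  have hspan : Submodule.span ℝ (Set.range col) = ⊤ := by
    by_contra hne
    obtain ⟨f, hf0, hf⟩ := Submodule.exists_dual_map_eq_bot_of_lt_top (lt_top_iff_ne_top.2 hne) inferInstance
    apply hf0
    have hfe : ∀ w : ι → ℝ, f w = ∑ a, f (Pi.single a 1) * w a := by
      intro w
      conv_lhs => rw [← Finset.univ_sum_single w, map_sum]
      refine Finset.sum_congr rfl fun a _ => ?_
      rw [← mul_one (w a), ← smul_eq_mul, Pi.single_smul', map_smul]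
      simp [mul_comm]
    have h1 := h (fun a => f (Pi.single a 1)) fun I => by
      have h2 : f (col I) ∈ (⊥ : Submodule ℝ ℝ) :=
        hf ▸ Submodule.mem_map_of_mem (Submodule.subset_span ⟨I, rfl⟩)
      rw [Submodule.mem_bot, hfe] at h2
      exact h2
    ext w
    simp [fun a => congrFun h1 a]
  obtain ⟨κ, e, he, hesp, hli⟩ := exists_linearIndependent' ℝ col
  rw [hspan] at hesp
  let B : Module.Basis κ ℝ (ι → ℝ) := Module.Basis.mk hli hesp.ge
  let eq : ι ≃ κ := (Pi.basisFun ℝ ι).indexEquiv B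
  refine ⟨⟨e ∘ eq, he.comp eq.injective⟩, ?_⟩
  have hli2 : LinearIndependent ℝ (fun b => col (e (eq b))) := hli.comp eq eq.injective
  rw [← Matrix.det_transpose]
  exact ((Matrix.linearIndependent_rows_iff_isUnit (A := (jacobianMinor φ (e ∘ eq) θ).transpose)).1 hli2 |>.map
    Matrix.detMonoidHom).ne_zero

/-- For a generic target `A`, the function `½ ‖A - φ‖²` has a nonsingular Hessian matrix at all
its critical points at which `φ` is an immersion. -/
theorem exists_polynomial_of_degenerate [DecidableEq τ] {φ : τ → (ι → ℝ) → ℝ}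
    (hφ : ∀ I, IsRegularFun (φ I)) :
    ∃ G : MvPolynomial τ ℝ, G ≠ 0 ∧ ∀ A θ, IsCriticalParam φ A θ →
      (∀ v : ι → ℝ, (∀ I, ∑ a, v a * partialDeriv a (φ I) θ = 0) → v = 0) →
        (sqDistHessian φ A θ).det = 0 → MvPolynomial.eval A G = 0 := by
  classical
  -- There are finitely many choices of columns S, and an immersion has a nonzero minor for one of
  -- them, so the product of all these polynomials serves.
  choose G hG0 hG using fun S : ι ↪ τ => exists_polynomial_of_minor hφ S
  refine ⟨∏ S, G S, Finset.prod_ne_zero_iff.2 fun S _ => hG0 S, fun A θ hcr himm hdeg => ?_⟩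
  obtain ⟨S, hS⟩ := exists_jacobianMinor_ne_zero himm
  rw [map_prod]
  exact Finset.prod_eq_zero (Finset.mem_univ S) (hG S A θ hcr hS hdeg)

/-! ### Derivatives of the squared distance -/

theorem partialDeriv_sqDist {φ : τ → (ι → ℝ) → ℝ} (hφ : ∀ I, Differentiable ℝ (φ I)) (A : τ → ℝ)
    (b : ι) :
    partialDeriv b (fun θ => 1 / 2 * ∑ I, (A I - φ I θ) ^ 2) =
      fun θ => -∑ I, partialDeriv b (φ I) θ * (A I - φ I θ) := by
  funext θ
  have h1 : HasFDerivAt (fun θ => 1 / 2 * ∑ I, (A I - φ I θ) ^ 2)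
      ((1 / 2 : ℝ) • ∑ I, (2 * (A I - φ I θ)) • -fderiv ℝ (φ I) θ) θ := by
    refine HasFDerivAt.const_mul (HasFDerivAt.fun_sum fun I _ => ?_) _
    have h := (hφ I θ).hasFDerivAt.const_sub (A I)
    simp only [sq]
    have h' := h.fun_mul h
    rwa [← add_smul, ← two_mul] at h'
  unfold partialDeriv
  rw [h1.fderiv]
  simp only [smul_apply, sum_apply, neg_apply, smul_eq_mul, Finset.mul_sum, ← Finset.sum_neg_distrib]
  refine Finset.sum_congr rfl fun I _ => ?_
  ring

theorem partialDeriv_partialDeriv_sqDist {φ : τ → (ι → ℝ) → ℝ}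
    (hφ : ∀ I, IsRegularFun (φ I)) (A : τ → ℝ) (a b : ι) (θ : ι → ℝ) :
    partialDeriv a (partialDeriv b (fun θ => 1 / 2 * ∑ I, (A I - φ I θ) ^ 2)) θ =
      sqDistHessian φ A θ a b := by
  have hd : ∀ I, Differentiable ℝ (φ I) := fun I => (hφ I).contDiff.differentiable (by simp)
  have hd2 : ∀ I, Differentiable ℝ (partialDeriv b (φ I)) := fun I =>
    ((hφ I).partialDeriv b).contDiff.differentiable (by simp)
  rw [partialDeriv_sqDist hd]
  have h1 : HasFDerivAt (fun θ => -∑ I, partialDeriv b (φ I) θ * (A I - φ I θ))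
      (-∑ I, (partialDeriv b (φ I) θ • -fderiv ℝ (φ I) θ +
        (A I - φ I θ) • fderiv ℝ (partialDeriv b (φ I)) θ)) θ :=
    HasFDerivAt.neg (HasFDerivAt.fun_sum fun I _ =>
      (hd2 I θ).hasFDerivAt.fun_mul ((hd I θ).hasFDerivAt.const_sub (A I)))
  rw [partialDeriv, h1.fderiv]
  simp only [neg_apply, sum_apply, add_apply, smul_apply, smul_eq_mul, sqDistHessian,
    Matrix.of_apply, ← Finset.sum_neg_distrib]
  refine Finset.sum_congr rfl fun I _ => ?_
  change -(_ * -partialDeriv a (φ I) θ + _ * partialDeriv a (partialDeriv b (φ I)) θ) = _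
  ring

end SquaredDistance

theorem hessianMatrix_eq {d : ℕ} {h : (Fin d → ℝ) → ℝ} (hh : ContDiff ℝ ∞ h) (w : Fin d → ℝ) :
    hessianMatrix h w = Matrix.of fun a b => partialDeriv a (partialDeriv b h) w := by
  ext a b
  have hd : Differentiable ℝ (fderiv ℝ h) :=
    (hh.fderiv_right (m := ∞) (by simp)).differentiable (by simp)
  simp only [hessianMatrix, Matrix.of_apply, iteratedFDeriv_two_apply]
  unfold partialDeriv
  rw [fderiv_clm_apply (hd w) (differentiableAt_const _)]
  simp

/-! ## The Cayley parametrization of the Stiefel manifold -/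

section Cayley

open Matrix

variable {ρ κ : Type} [Fintype ρ] [DecidableEq ρ] [Fintype κ]

/-- For every square matrix `B` there is a diagonal sign matrix `D` such that `D + B` is
invertible. -/
theorem exists_sign_det_ne_zero {r : ℕ} (B : Matrix (Fin r) (Fin r) ℝ) :
    ∃ ε : Fin r → ℤˣ, (diagonal (fun j => ((ε j : ℤ) : ℝ)) + B).det ≠ 0 := by
  induction r with
  | zero => exact ⟨fun _ => 1, by simp⟩
  | succ r ih =>
    obtain ⟨ε, hε⟩ := ih (B.submatrix Fin.succ Fin.succ)
    by_contra! hall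
    -- The determinant is affine in the first sign s, and its slope is the smaller determinant,
    -- nonzero by induction. It cannot vanish at both s = 1 and s = −1.
    let N : ℤˣ → Matrix (Fin (r + 1)) (Fin (r + 1)) ℝ := fun s =>
      diagonal (fun j => (((Fin.cons s ε : Fin (r + 1) → ℤˣ) j : ℤ) : ℝ)) + B
    have hN : ∀ s, N s = updateRow (N 1) 0 (B 0 + ((s : ℤ) : ℝ) • Pi.single 0 1) := by
      intro s
      ext a b
      refine Fin.cases ?_ (fun a => ?_) a
      · simp only [N, updateRow_self, Matrix.add_apply, diagonal_apply, Fin.cons_zero, Pi.add_apply,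
          Pi.smul_apply, Pi.single_apply, smul_eq_mul, mul_ite, mul_one, mul_zero, @eq_comm _ b 0]
        ring
      · rw [updateRow_ne (Fin.succ_ne_zero a)]
        simp [N, Matrix.add_apply, diagonal_apply]
    have hdet : ∀ s, (N s).det = ((updateRow (N 1) 0 (B 0)).det) + ((s : ℤ) : ℝ) *
        (updateRow (N 1) 0 (Pi.single 0 1)).det := by
      intro s
      rw [hN s, det_updateRow_add, det_updateRow_smul]
    have hminor : (updateRow (N 1) 0 (Pi.single 0 1)).det ≠ 0 := by
      rw [det_succ_row_zero, Finset.sum_eq_single 0]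
      · convert hε using 1
        simp only [Fin.val_zero, pow_zero, updateRow_self, Pi.single_eq_same, one_mul]
        congr 1
        ext a b
        simp [N, submatrix_apply, diagonal_apply]
      · intro b _ hb
        simp [hb]
      · simp
    have h1 := hdet 1
    have h2 := hdet (-1)
    rw [show (N 1).det = 0 from hall _] at h1
    rw [show (N (-1)).det = 0 from hall _] at h2
    push_cast at h1 h2
    exact hminor (by linarith)

/-- The matrix `1 + Zᵀ Z - T` inverted by the Cayley parametrization. -/
def cayleyCore (T : Matrix ρ ρ ℝ) (Z : Matrix κ ρ ℝ) : Matrix ρ ρ ℝ := 1 + Zᵀ * Z - T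

/-- Since T is skew, the quadratic form of the core at v is |v|² + |Zv|². -/
theorem cayleyCore_det_ne_zero {T : Matrix ρ ρ ℝ} (hT : Tᵀ = -T) (Z : Matrix κ ρ ℝ) :
    (cayleyCore T Z).det ≠ 0 := by
  intro h
  obtain ⟨v, hv, hv0⟩ := exists_mulVec_eq_zero_iff.2 h
  have h1 : v ⬝ᵥ T *ᵥ v = 0 := by
    have h2 : v ⬝ᵥ T *ᵥ v = v ⬝ᵥ Tᵀ *ᵥ v := by
      rw [mulVec_transpose, dotProduct_mulVec, dotProduct_comm]
    rw [hT, neg_mulVec, dotProduct_neg] at h2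
    linarith
  have h2 : v ⬝ᵥ cayleyCore T Z *ᵥ v = v ⬝ᵥ v + (Z *ᵥ v) ⬝ᵥ (Z *ᵥ v) - v ⬝ᵥ T *ᵥ v := by
    rw [cayleyCore, sub_mulVec, add_mulVec, one_mulVec, dotProduct_sub, dotProduct_add,
      ← mulVec_mulVec, dotProduct_mulVec v Zᵀ, vecMul_transpose]
  rw [hv0, h1, dotProduct_zero, sub_zero] at h2
  have h3 : 0 ≤ v ⬝ᵥ v := Finset.sum_nonneg fun i _ => mul_self_nonneg _
  have h4 : 0 ≤ (Z *ᵥ v) ⬝ᵥ (Z *ᵥ v) := Finset.sum_nonneg fun i _ => mul_self_nonneg _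
  exact hv (dotProduct_self_eq_zero.1 (by linarith))

/-- The upper block of the Cayley parametrization with signs `D`. -/
noncomputable def cayleyTop (D T : Matrix ρ ρ ℝ) (Z : Matrix κ ρ ℝ) : Matrix ρ ρ ℝ :=
  D * (2 * (cayleyCore T Z)⁻¹ - 1)

/-- The lower block of the Cayley parametrization. -/
noncomputable def cayleyBot (T : Matrix ρ ρ ℝ) (Z : Matrix κ ρ ℝ) : Matrix κ ρ ℝ :=
  Z * (2 * (cayleyCore T Z)⁻¹)

/-- The core matrix recovered from the upper block. -/
noncomputable def coreOfTop (D X : Matrix ρ ρ ℝ) : Matrix ρ ρ ℝ := 2 * (1 + D * X)⁻¹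

/-- The parameter `Z` recovered from the two blocks. -/
noncomputable def lowerOfBlocks (D X : Matrix ρ ρ ℝ) (Y : Matrix κ ρ ℝ) : Matrix κ ρ ℝ :=
  (1 / 2 : ℝ) • (Y * coreOfTop D X)

/-- The parameter `T` recovered from the two blocks. -/
noncomputable def skewOfBlocks (D X : Matrix ρ ρ ℝ) (Y : Matrix κ ρ ℝ) : Matrix ρ ρ ℝ :=
  1 + (lowerOfBlocks D X Y)ᵀ * lowerOfBlocks D X Y - coreOfTop D X

/-- Let M be the core and N its inverse. Since T is skew, 2ZᵀZ = M + Mᵀ − 2. Inserting this into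
(2Nᵀ − 1)(2N − 1) + 4NᵀZᵀZN, everything but 1 cancels. -/
theorem cayley_orthonormal {D T : Matrix ρ ρ ℝ} (hD : Dᵀ * D = 1) (hT : Tᵀ = -T)
    (Z : Matrix κ ρ ℝ) :
    (cayleyTop D T Z)ᵀ * cayleyTop D T Z + (cayleyBot T Z)ᵀ * cayleyBot T Z = 1 := by
  have hdet : IsUnit (cayleyCore T Z).det := (cayleyCore_det_ne_zero hT Z).isUnit
  have hM : (cayleyCore T Z)ᵀ = 1 + Zᵀ * Z + T := by
    simp [cayleyCore, transpose_mul, hT]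
  have hG : 2 * (Zᵀ * Z) = cayleyCore T Z + (cayleyCore T Z)ᵀ - 2 := by
    rw [hM, cayleyCore]
    noncomm_ring
    simp
  have hMN := mul_nonsing_inv (cayleyCore T Z) hdet
  have hNM : ((cayleyCore T Z)⁻¹)ᵀ * (cayleyCore T Z)ᵀ = 1 := by
    rw [← transpose_mul, hMN, transpose_one]
  have h2t : (2 : Matrix ρ ρ ℝ)ᵀ = 2 := by
    rw [← one_add_one_eq_two, transpose_add, transpose_one]
  have h1 : (cayleyTop D T Z)ᵀ * cayleyTop D T Z =
      (2 * ((cayleyCore T Z)⁻¹)ᵀ - 1) * (2 * (cayleyCore T Z)⁻¹ - 1) := by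
    rw [cayleyTop, transpose_mul, Matrix.mul_assoc, ← Matrix.mul_assoc Dᵀ, hD, Matrix.one_mul,
      transpose_sub, transpose_mul, h2t, transpose_one, mul_two, ← two_mul]
  have h2 : (cayleyBot T Z)ᵀ * cayleyBot T Z =
      2 * ((cayleyCore T Z)⁻¹)ᵀ * (2 * (Zᵀ * Z)) * (cayleyCore T Z)⁻¹ := by
    rw [cayleyBot, transpose_mul, transpose_mul, h2t]
    simp only [two_mul, mul_two, Matrix.mul_add, Matrix.add_mul, Matrix.mul_assoc]
  rw [h1, h2, hG]
  generalize (cayleyCore T Z)ᵀ = Mt at *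
  generalize (cayleyCore T Z) = M at *
  generalize (M⁻¹)ᵀ = Nt at *
  generalize M⁻¹ = N at *
  have e : (2 * Nt - 1) * (2 * N - 1) + 2 * Nt * (M + Mt - 2) * N =
      1 + 2 * (Nt * (M * N) - Nt) + 2 * (Nt * Mt * N - N) := by noncomm_ring
  rw [e, hMN, hNM]
  simp

/-- With M the core, the upper block X satisfies 1 + DX = 2M⁻¹, so X alone determines M. The lower
block then gives Z, and Z and M give T. -/
theorem coreOfTop_cayleyTop {D T : Matrix ρ ρ ℝ} (hD : D * D = 1) (hT : Tᵀ = -T)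
    (Z : Matrix κ ρ ℝ) : coreOfTop D (cayleyTop D T Z) = cayleyCore T Z := by
  have hdet : IsUnit (cayleyCore T Z).det := (cayleyCore_det_ne_zero hT Z).isUnit
  rw [coreOfTop, cayleyTop, ← Matrix.mul_assoc, hD, Matrix.one_mul, add_sub_cancel]
  have h : (2 * (cayleyCore T Z)⁻¹)⁻¹ = (1 / 2 : ℝ) • cayleyCore T Z := by
    apply inv_eq_right_inv
    rw [two_mul, Matrix.mul_smul, Matrix.add_mul, nonsing_inv_mul _ hdet, smul_add, ← add_smul]
    norm_num
  rw [h, two_mul, ← add_smul]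
  norm_num

theorem one_add_mul_cayleyTop_det_ne_zero {D T : Matrix ρ ρ ℝ} (hD : D * D = 1) (hT : Tᵀ = -T)
    (Z : Matrix κ ρ ℝ) : (1 + D * cayleyTop D T Z).det ≠ 0 := by
  have hdet : IsUnit (cayleyCore T Z).det := (cayleyCore_det_ne_zero hT Z).isUnit
  rw [cayleyTop, ← Matrix.mul_assoc, hD, Matrix.one_mul, add_sub_cancel]
  have h : (2 * (cayleyCore T Z)⁻¹) * ((1 / 2 : ℝ) • cayleyCore T Z) = 1 := by
    rw [two_mul, Matrix.mul_smul, Matrix.add_mul, nonsing_inv_mul _ hdet, smul_add, ← add_smul]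
    norm_num
  intro h0
  have := congrArg det h
  rw [det_mul, h0, zero_mul, det_one] at this
  exact zero_ne_one this

theorem lowerOfBlocks_cayley {D T : Matrix ρ ρ ℝ} (hD : D * D = 1) (hT : Tᵀ = -T)
    (Z : Matrix κ ρ ℝ) : lowerOfBlocks D (cayleyTop D T Z) (cayleyBot T Z) = Z := by
  have hdet : IsUnit (cayleyCore T Z).det := (cayleyCore_det_ne_zero hT Z).isUnit
  rw [lowerOfBlocks, coreOfTop_cayleyTop hD hT, cayleyBot, two_mul, Matrix.mul_assoc,
    Matrix.add_mul, nonsing_inv_mul _ hdet, Matrix.mul_add, Matrix.mul_one, smul_add, ← add_smul]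
  norm_num

theorem skewOfBlocks_cayley {D T : Matrix ρ ρ ℝ} (hD : D * D = 1) (hT : Tᵀ = -T)
    (Z : Matrix κ ρ ℝ) : skewOfBlocks D (cayleyTop D T Z) (cayleyBot T Z) = T := by
  rw [skewOfBlocks, lowerOfBlocks_cayley hD hT, coreOfTop_cayleyTop hD hT, cayleyCore]
  abel

/-- Put W = DX and M = 2(1 + W)⁻¹. Skewness amounts to 4ZᵀZ + 4 − 2M − 2Mᵀ = 0. Multiplying by the
invertible 1 + Wᵀ on the left and 1 + W on the right turns this into a polynomial identity in W and
Wᵀ, by YᵀY = 1 − WᵀW. -/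
theorem skewOfBlocks_transpose {D X : Matrix ρ ρ ℝ} {Y : Matrix κ ρ ℝ} (hD : Dᵀ * D = 1)
    (hXY : Xᵀ * X + Yᵀ * Y = 1) (hdet : (1 + D * X).det ≠ 0) :
    (skewOfBlocks D X Y)ᵀ = -skewOfBlocks D X Y := by
  have hu : IsUnit (1 + D * X).det := hdet.isUnit
  have h2t : (2 : Matrix ρ ρ ℝ)ᵀ = 2 := by
    rw [← one_add_one_eq_two, transpose_add, transpose_one]
  have hW : (D * X)ᵀ * (D * X) = Xᵀ * X := by
    rw [transpose_mul, Matrix.mul_assoc, ← Matrix.mul_assoc Dᵀ, hD, Matrix.one_mul]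
  have hfour : (4 : Matrix ρ ρ ℝ) = (4 : ℝ) • 1 := by
    ext i j
    by_cases h : i = j <;> simp [h, Matrix.ofNat_apply]
  have hZ : 4 * ((lowerOfBlocks D X Y)ᵀ * lowerOfBlocks D X Y) =
      (coreOfTop D X)ᵀ * (Yᵀ * Y) * coreOfTop D X := by
    rw [lowerOfBlocks, transpose_smul, transpose_mul, hfour, smul_mul, Matrix.one_mul, smul_mul,
      Matrix.mul_smul, smul_smul, smul_smul]
    norm_num
    simp only [Matrix.mul_assoc]
  have hMN : coreOfTop D X * (1 + D * X) = 2 := by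
    rw [coreOfTop, Matrix.mul_assoc, nonsing_inv_mul _ hu, Matrix.mul_one]
  have hNM : (1 + (D * X)ᵀ) * (coreOfTop D X)ᵀ = 2 := by
    have := congrArg transpose hMN
    rwa [transpose_mul, h2t, transpose_add, transpose_one] at this
  have hcore : (coreOfTop D X)ᵀ * (Yᵀ * Y) * coreOfTop D X + 4 - 2 * coreOfTop D X -
      2 * (coreOfTop D X)ᵀ = 0 := by
    have hu' : IsUnit (1 + D * X) := (isUnit_iff_isUnit_det _).2 hu
    have hu'' : IsUnit (1 + (D * X)ᵀ) := by
      rw [isUnit_iff_isUnit_det]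
      have : 1 + (D * X)ᵀ = (1 + D * X)ᵀ := by simp
      rwa [this, det_transpose]
    rw [← hu'.mul_left_eq_zero, ← hu''.mul_right_eq_zero]
    have hYY : Yᵀ * Y = 1 - (D * X)ᵀ * (D * X) := by rw [hW, ← hXY]; abel
    rw [hYY]
    generalize (D * X)ᵀ = Wt at *
    generalize D * X = W at *
    generalize (coreOfTop D X)ᵀ = Mt at *
    generalize coreOfTop D X = M at *
    have e : (1 + Wt) * ((Mt * (1 - Wt * W) * M + 4 - 2 * M - 2 * Mt) * (1 + W)) =
        ((1 + Wt) * Mt) * (1 - Wt * W) * (M * (1 + W)) + 4 * ((1 + Wt) * (1 + W))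
          - 2 * ((1 + Wt) * (M * (1 + W))) - 2 * (((1 + Wt) * Mt) * (1 + W)) := by
      noncomm_ring
    rw [e, hMN, hNM]
    noncomm_ring
  have h4 : (4 : ℝ) • ((skewOfBlocks D X Y)ᵀ + skewOfBlocks D X Y) = 0 := by
    have h4' : (4 : ℝ) • ((skewOfBlocks D X Y)ᵀ + skewOfBlocks D X Y) =
        4 * ((skewOfBlocks D X Y)ᵀ + skewOfBlocks D X Y) := by
      rw [hfour, smul_mul, Matrix.one_mul]
    have h1111 : (4 : Matrix ρ ρ ℝ) = 1 + 1 + 1 + 1 := by norm_num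
    have hcore' := hcore
    rw [h1111] at hcore'
    rw [h4', skewOfBlocks, transpose_sub, transpose_add, transpose_one, transpose_mul,
      transpose_transpose]
    generalize (lowerOfBlocks D X Y)ᵀ * lowerOfBlocks D X Y = G at *
    generalize (coreOfTop D X)ᵀ = Mt at *
    generalize coreOfTop D X = M at *
    have e : 4 * (1 + G - Mt + (1 + G - M)) =
        2 * (4 * G + (1 + 1 + 1 + 1) - 2 * M - 2 * Mt) := by noncomm_ring
    rw [e, hZ, hcore', mul_zero]
  rw [smul_eq_zero] at h4
  exact eq_neg_of_add_eq_zero_left (h4.resolve_left (by norm_num))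

theorem cayleyCore_ofBlocks (D X : Matrix ρ ρ ℝ) (Y : Matrix κ ρ ℝ) :
    cayleyCore (skewOfBlocks D X Y) (lowerOfBlocks D X Y) = coreOfTop D X := by
  rw [cayleyCore, skewOfBlocks]
  abel

theorem two_mul_inv_coreOfTop {D X : Matrix ρ ρ ℝ} (hdet : (1 + D * X).det ≠ 0) :
    2 * (coreOfTop D X)⁻¹ = 1 + D * X := by
  have hu : IsUnit (1 + D * X).det := hdet.isUnit
  have h : (coreOfTop D X)⁻¹ = (1 / 2 : ℝ) • (1 + D * X) := by
    apply inv_eq_right_inv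
    rw [coreOfTop, two_mul, Matrix.mul_smul, Matrix.add_mul, nonsing_inv_mul _ hu, smul_add,
      ← add_smul]
    norm_num
  rw [h, two_mul, ← add_smul]
  norm_num

theorem cayleyTop_ofBlocks {D X : Matrix ρ ρ ℝ} (Y : Matrix κ ρ ℝ) (hD : D * D = 1)
    (hdet : (1 + D * X).det ≠ 0) :
    cayleyTop D (skewOfBlocks D X Y) (lowerOfBlocks D X Y) = X := by
  rw [cayleyTop, cayleyCore_ofBlocks, two_mul_inv_coreOfTop hdet, add_sub_cancel_left,
    ← Matrix.mul_assoc, hD, Matrix.one_mul]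

theorem cayleyBot_ofBlocks {D X : Matrix ρ ρ ℝ} (Y : Matrix κ ρ ℝ)
    (hdet : (1 + D * X).det ≠ 0) :
    cayleyBot (skewOfBlocks D X Y) (lowerOfBlocks D X Y) = Y := by
  have hu : IsUnit (1 + D * X).det := hdet.isUnit
  rw [cayleyBot, cayleyCore_ofBlocks, two_mul_inv_coreOfTop hdet, lowerOfBlocks, smul_mul,
    Matrix.mul_assoc, coreOfTop, Matrix.mul_assoc, nonsing_inv_mul _ hu, Matrix.mul_one,
    show (2 : Matrix ρ ρ ℝ) = 1 + 1 from one_add_one_eq_two.symm, Matrix.mul_add,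
    Matrix.mul_one, smul_add, ← add_smul]
  norm_num

end Cayley

/-! ## Charts of the parameter manifold -/

section MatrixSmoothness

variable {E : Type*} [NormedAddCommGroup E] [NormedSpace ℝ E] {x : E}

theorem contDiffAt_det {ι : Type*} [Fintype ι] [DecidableEq ι] {F : E → Matrix ι ι ℝ}
    (h : ∀ a b, ContDiffAt ℝ ∞ (fun y => F y a b) x) : ContDiffAt ℝ ∞ (fun y => (F y).det) x := by
  simp only [Matrix.det_apply']
  exact ContDiffAt.sum fun p _ => contDiffAt_const.mul (contDiffAt_prod fun i _ => h _ _)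

theorem contDiffAt_matrix_inv {ι : Type*} [Fintype ι] [DecidableEq ι] {F : E → Matrix ι ι ℝ}
    (h : ∀ a b, ContDiffAt ℝ ∞ (fun y => F y a b) x) (h0 : (F x).det ≠ 0) (a b : ι) :
    ContDiffAt ℝ ∞ (fun y => (F y)⁻¹ a b) x := by
  simp only [Matrix.inv_def, Ring.inverse_eq_inv', Matrix.smul_apply, smul_eq_mul,
    Matrix.adjugate_apply]
  refine ((contDiffAt_det h).inv h0).mul (contDiffAt_det fun c d => ?_)
  simp only [Matrix.updateRow_apply]
  split_ifs
  · exact contDiffAt_const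
  · exact h _ _

theorem contDiffAt_matrix_mul {ι κ μ : Type*} [Fintype κ] {F : E → Matrix ι κ ℝ}
    {G : E → Matrix κ μ ℝ} (hF : ∀ a b, ContDiffAt ℝ ∞ (fun y => F y a b) x)
    (hG : ∀ a b, ContDiffAt ℝ ∞ (fun y => G y a b) x) (a : ι) (b : μ) :
    ContDiffAt ℝ ∞ (fun y => (F y * G y) a b) x := by
  simp only [Matrix.mul_apply]
  exact ContDiffAt.sum fun c _ => (hF _ _).mul (hG _ _)

end MatrixSmoothness

theorem IsRegularFun.matrix_mul {σ : Type} {ι κ μ : Type*} [Fintype κ]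
    {F : (σ → ℝ) → Matrix ι κ ℝ} {G : (σ → ℝ) → Matrix κ μ ℝ}
    (hF : ∀ a b, IsRegularFun fun y => F y a b) (hG : ∀ a b, IsRegularFun fun y => G y a b)
    (a : ι) (b : μ) : IsRegularFun fun y => (F y * G y) a b := by
  simp only [Matrix.mul_apply]
  exact IsRegularFun.sum _ fun c _ => (hF _ _).mul (hG _ _)

variable {k : ℕ} {n : Fin k → ℕ} {r : ℕ}

/-- The coordinates of the charts: for each mode the entries above the diagonal of a skew-symmetric
matrix and the entries of a rectangular matrix, and the weights. -/
abbrev ChartIndex {k : ℕ} (n : Fin k → ℕ) (r : ℕ) : Type :=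
  (Σ i : Fin k, {p : Fin r × Fin r // p.1 < p.2} ⊕ (Fin (n i - r) × Fin r)) ⊕ Fin r

/-- Splitting of the rows of an `m × r` matrix into the first `r` ones and the others. -/
def rowEquiv {r m : ℕ} (h : r ≤ m) : Fin r ⊕ Fin (m - r) ≃ Fin m :=
  finSumFinEquiv.trans (finCongr (by omega))

/-- The first `r` rows. -/
def topBlock {r m : ℕ} (h : r ≤ m) (U : Matrix (Fin m) (Fin r) ℝ) : Matrix (Fin r) (Fin r) ℝ :=
  U.submatrix (fun a => rowEquiv h (Sum.inl a)) id

/-- The rows after the first `r`. -/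
def botBlock {r m : ℕ} (h : r ≤ m) (U : Matrix (Fin m) (Fin r) ℝ) :
    Matrix (Fin (m - r)) (Fin r) ℝ :=
  U.submatrix (fun a => rowEquiv h (Sum.inr a)) id

/-- The matrix with given upper and lower blocks. -/
def ofBlocks {r m : ℕ} (h : r ≤ m) (X : Matrix (Fin r) (Fin r) ℝ)
    (Y : Matrix (Fin (m - r)) (Fin r) ℝ) : Matrix (Fin m) (Fin r) ℝ :=
  (Matrix.fromRows X Y).submatrix (rowEquiv h).symm id

@[simp] theorem topBlock_ofBlocks {r m : ℕ} (h : r ≤ m) (X : Matrix (Fin r) (Fin r) ℝ)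
    (Y : Matrix (Fin (m - r)) (Fin r) ℝ) : topBlock h (ofBlocks h X Y) = X := by
  ext a b
  simp [topBlock, ofBlocks]

@[simp] theorem botBlock_ofBlocks {r m : ℕ} (h : r ≤ m) (X : Matrix (Fin r) (Fin r) ℝ)
    (Y : Matrix (Fin (m - r)) (Fin r) ℝ) : botBlock h (ofBlocks h X Y) = Y := by
  ext a b
  simp [botBlock, ofBlocks]

@[simp] theorem ofBlocks_blocks {r m : ℕ} (h : r ≤ m) (U : Matrix (Fin m) (Fin r) ℝ) :
    ofBlocks h (topBlock h U) (botBlock h U) = U := by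
  ext a b
  obtain ⟨s, rfl⟩ := (rowEquiv h).surjective a
  cases s <;> simp [topBlock, botBlock, ofBlocks]

theorem transpose_mul_self_eq_blocks {r m : ℕ} (h : r ≤ m) (U : Matrix (Fin m) (Fin r) ℝ) :
    U.transpose * U = (topBlock h U).transpose * topBlock h U +
      (botBlock h U).transpose * botBlock h U := by
  ext a b
  simp only [Matrix.mul_apply, Matrix.transpose_apply, Matrix.add_apply, topBlock, botBlock,
    Matrix.submatrix_apply, id]
  rw [← (rowEquiv h).sum_comp, Fintype.sum_sum_type]

/-- The diagonal matrix of a sign vector. -/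
def signDiag (ε : Fin r → ℤˣ) : Matrix (Fin r) (Fin r) ℝ :=
  Matrix.diagonal fun j => ((ε j : ℤ) : ℝ)

theorem signDiag_mul_self (ε : Fin r → ℤˣ) : signDiag ε * signDiag ε = 1 := by
  rw [signDiag, Matrix.diagonal_mul_diagonal, ← Matrix.diagonal_one]
  congr 1
  funext j
  rcases Int.units_eq_one_or (ε j) with h | h <;> simp [h]

theorem signDiag_transpose_mul_self (ε : Fin r → ℤˣ) :
    (signDiag ε).transpose * signDiag ε = 1 := by
  have : (signDiag ε).transpose = signDiag ε := Matrix.diagonal_transpose _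
  rw [this, signDiag_mul_self]

/-- The skew-symmetric matrix among the chart coordinates. -/
def skewPart (v : ChartIndex n r → ℝ) (i : Fin k) : Matrix (Fin r) (Fin r) ℝ :=
  Matrix.of fun a b => if h : a < b then v (Sum.inl ⟨i, Sum.inl ⟨(a, b), h⟩⟩)
    else if h : b < a then -v (Sum.inl ⟨i, Sum.inl ⟨(b, a), h⟩⟩) else 0

/-- The rectangular matrix among the chart coordinates. -/
def lowerPart (v : ChartIndex n r → ℝ) (i : Fin k) : Matrix (Fin (n i - r)) (Fin r) ℝ :=
  Matrix.of fun a b => v (Sum.inl ⟨i, Sum.inr (a, b)⟩)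

theorem skewPart_transpose (v : ChartIndex n r → ℝ) (i : Fin k) :
    (skewPart v i).transpose = -skewPart v i := by
  ext a b
  simp only [skewPart, Matrix.transpose_apply, Matrix.of_apply, Matrix.neg_apply]
  rcases lt_trichotomy a b with h | h | h
  · simp [h, h.not_gt]
  · simp [h]
  · simp [h, h.not_gt]

/-- The inverse of a chart of the parameter manifold. -/
noncomputable def chartPoint (hrn : ∀ i, r ≤ n i) (ε : Fin k → Fin r → ℤˣ)
    (v : ChartIndex n r → ℝ) : Factors n r × (Fin r → ℝ) :=
  (fun i => ofBlocks (hrn i) (cayleyTop (signDiag (ε i)) (skewPart v i) (lowerPart v i))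
    (cayleyBot (skewPart v i) (lowerPart v i)), fun j => v (Sum.inr j))

/-- The coordinates of a point in a chart of the parameter manifold. -/
noncomputable def chartCoord (hrn : ∀ i, r ≤ n i) (ε : Fin k → Fin r → ℤˣ)
    (z : Factors n r × (Fin r → ℝ)) : ChartIndex n r → ℝ :=
  Sum.elim (fun s => Sum.elim
    (fun p => skewOfBlocks (signDiag (ε s.1)) (topBlock (hrn s.1) (z.1 s.1))
      (botBlock (hrn s.1) (z.1 s.1)) p.1.1 p.1.2)
    (fun p => lowerOfBlocks (signDiag (ε s.1)) (topBlock (hrn s.1) (z.1 s.1))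
      (botBlock (hrn s.1) (z.1 s.1)) p.1 p.2) s.2) z.2

/-- The open set whose intersection with the parameter manifold is the domain of a chart. -/
def chartDomain (hrn : ∀ i, r ≤ n i) (ε : Fin k → Fin r → ℤˣ) :
    Set (Factors n r × (Fin r → ℝ)) :=
  {z | (∀ i, (1 + signDiag (ε i) * topBlock (hrn i) (z.1 i)).det ≠ 0) ∧ ∀ j, z.2 j ≠ 0}

theorem chartPoint_mem_stiefelProd (hrn : ∀ i, r ≤ n i) (ε : Fin k → Fin r → ℤˣ)
    (v : ChartIndex n r → ℝ) : (chartPoint hrn ε v).1 ∈ stiefelProd n r := by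
  intro i
  rw [transpose_mul_self_eq_blocks (hrn i)]
  simp only [chartPoint, topBlock_ofBlocks, botBlock_ofBlocks]
  exact cayley_orthonormal (signDiag_transpose_mul_self _) (skewPart_transpose v i) _

theorem chartPoint_mem_chartDomain (hrn : ∀ i, r ≤ n i) (ε : Fin k → Fin r → ℤˣ)
    {v : ChartIndex n r → ℝ} (hv : ∀ j, v (Sum.inr j) ≠ 0) :
    chartPoint hrn ε v ∈ chartDomain hrn ε := by
  refine ⟨fun i => ?_, hv⟩
  simp only [chartPoint, topBlock_ofBlocks]
  exact one_add_mul_cayleyTop_det_ne_zero (signDiag_mul_self _) (skewPart_transpose v i) _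

theorem chartCoord_chartPoint (hrn : ∀ i, r ≤ n i) (ε : Fin k → Fin r → ℤˣ)
    (v : ChartIndex n r → ℝ) : chartCoord hrn ε (chartPoint hrn ε v) = v := by
  funext q
  rcases q with ⟨i, p | p⟩ | j
  · simp only [chartCoord, chartPoint, Sum.elim_inl, topBlock_ofBlocks, botBlock_ofBlocks]
    rw [skewOfBlocks_cayley (signDiag_mul_self _) (skewPart_transpose v i)]
    simp [skewPart, p.2]
  · simp only [chartCoord, chartPoint, Sum.elim_inl, Sum.elim_inr, topBlock_ofBlocks,
      botBlock_ofBlocks]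
    rw [lowerOfBlocks_cayley (signDiag_mul_self _) (skewPart_transpose v i)]
    simp [lowerPart]
  · rfl

/-- The coordinates keep only the entries above the diagonal; the others are recovered because the
matrix is skew at points of the Stiefel manifold. -/
theorem skewPart_chartCoord (hrn : ∀ i, r ≤ n i) (ε : Fin k → Fin r → ℤˣ)
    {z : Factors n r × (Fin r → ℝ)} (hz : z.1 ∈ stiefelProd n r) (hz' : z ∈ chartDomain hrn ε)
    (i : Fin k) : skewPart (chartCoord hrn ε z) i =
      skewOfBlocks (signDiag (ε i)) (topBlock (hrn i) (z.1 i)) (botBlock (hrn i) (z.1 i)) := by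
  have hsk := skewOfBlocks_transpose (signDiag_transpose_mul_self (ε i))
    ((transpose_mul_self_eq_blocks (hrn i) (z.1 i)).symm.trans (hz i)) (hz'.1 i)
  ext a b
  have h1 : ∀ a b, skewOfBlocks (signDiag (ε i)) (topBlock (hrn i) (z.1 i))
      (botBlock (hrn i) (z.1 i)) b a = -skewOfBlocks (signDiag (ε i)) (topBlock (hrn i) (z.1 i))
      (botBlock (hrn i) (z.1 i)) a b := fun a b => congrFun (congrFun hsk a) b
  simp only [skewPart, Matrix.of_apply, chartCoord, Sum.elim_inl]
  rcases lt_trichotomy a b with h | h | h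
  · simp [h]
  · subst h
    have := h1 a a
    simp only [lt_self_iff_false, dite_false]
    linarith
  · simp only [h, h.not_gt, dite_true, dite_false]
    rw [h1, neg_neg]

theorem chartPoint_chartCoord (hrn : ∀ i, r ≤ n i) (ε : Fin k → Fin r → ℤˣ)
    {z : Factors n r × (Fin r → ℝ)} (hz : z.1 ∈ stiefelProd n r) (hz' : z ∈ chartDomain hrn ε) :
    chartPoint hrn ε (chartCoord hrn ε z) = z := by
  refine Prod.ext (funext fun i => ?_) rfl
  have hl : lowerPart (chartCoord hrn ε z) i = lowerOfBlocks (signDiag (ε i))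
      (topBlock (hrn i) (z.1 i)) (botBlock (hrn i) (z.1 i)) := rfl
  simp only [chartPoint]
  rw [skewPart_chartCoord hrn ε hz hz', hl, cayleyTop_ofBlocks _ (signDiag_mul_self _) (hz'.1 i),
    cayleyBot_ofBlocks _ (hz'.1 i), ofBlocks_blocks]

theorem exists_mem_chartDomain (hrn : ∀ i, r ≤ n i) (z : Factors n r × (Fin r → ℝ))
    (hz : ∀ j, z.2 j ≠ 0) : ∃ ε, z ∈ chartDomain hrn ε := by
  choose ε hε using fun i => exists_sign_det_ne_zero (topBlock (hrn i) (z.1 i))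
  refine ⟨ε, fun i => ?_, hz⟩
  -- Since D² = 1, the chart condition on 1 + DX is equivalent to invertibility of D + X, which a
  -- choice of signs ensures.
  have h1 : 1 + signDiag (ε i) * topBlock (hrn i) (z.1 i) =
      signDiag (ε i) * (signDiag (ε i) + topBlock (hrn i) (z.1 i)) := by
    rw [Matrix.mul_add, signDiag_mul_self]
  rw [h1, Matrix.det_mul]
  refine mul_ne_zero (fun h => ?_) (hε i)
  have h2 := congrArg Matrix.det (signDiag_mul_self (ε i))
  rw [Matrix.det_mul, h, zero_mul, Matrix.det_one] at h2
  exact zero_ne_one h2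

/-! ### Smoothness of the charts -/

theorem isRegularFun_chartPoint {σ : Type} (hrn : ∀ i, r ≤ n i) (ε : Fin k → Fin r → ℤˣ)
    (e : ChartIndex n r → σ) (i : Fin k) (a : Fin (n i)) (b : Fin r) :
    IsRegularFun fun w : σ → ℝ => (chartPoint hrn ε (w ∘ e)).1 i a b := by
  have hT : ∀ a b, IsRegularFun fun w : σ → ℝ => skewPart (n := n) (w ∘ e) i a b := by
    intro a b
    simp only [skewPart, Matrix.of_apply]
    split_ifs
    · exact IsRegularFun.coord _
    · exact (IsRegularFun.coord _).neg
    · exact IsRegularFun.const 0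
  have hZ : ∀ a b, IsRegularFun fun w : σ → ℝ => lowerPart (n := n) (w ∘ e) i a b := fun a b =>
    IsRegularFun.coord _
  have hM : ∀ a b, IsRegularFun fun w : σ → ℝ =>
      cayleyCore (skewPart (n := n) (w ∘ e) i) (lowerPart (w ∘ e) i) a b := fun a b =>
    ((IsRegularFun.const _).add (IsRegularFun.matrix_mul (fun a b => hZ b a) hZ a b)).sub (hT a b)
  have hN := IsRegularFun.matrix_inv hM fun w =>
    cayleyCore_det_ne_zero (skewPart_transpose (n := n) (w ∘ e) i) _
  have h2N : ∀ a b, IsRegularFun fun w : σ → ℝ =>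
      ((2 : Matrix (Fin r) (Fin r) ℝ) *
        (cayleyCore (skewPart (n := n) (w ∘ e) i) (lowerPart (w ∘ e) i))⁻¹) a b := fun a b =>
    IsRegularFun.matrix_mul (F := fun _ => 2) (fun _ _ => IsRegularFun.const _) hN a b
  obtain ⟨s, rfl⟩ := (rowEquiv (hrn i)).surjective a
  rcases s with s | s
  · simp only [chartPoint, ofBlocks, Matrix.submatrix_apply, Equiv.symm_apply_apply, id,
      Matrix.fromRows_apply_inl, cayleyTop]
    exact IsRegularFun.matrix_mul (F := fun _ => signDiag (ε i)) (fun _ _ => IsRegularFun.const _)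
      (fun a b => (h2N a b).sub (IsRegularFun.const _)) s b
  · simp only [chartPoint, ofBlocks, Matrix.submatrix_apply, Equiv.symm_apply_apply, id,
      Matrix.fromRows_apply_inr, cayleyBot]
    exact IsRegularFun.matrix_mul hZ h2N s b

/-- An entry of the factors, as a continuous linear functional. -/
noncomputable def entryCLM (i : Fin k) (a : Fin (n i)) (b : Fin r) :
    (Factors n r × (Fin r → ℝ)) →L[ℝ] ℝ :=
  LinearMap.toContinuousLinearMap
    { toFun := fun z => z.1 i a b
      map_add' := fun _ _ => rfl
      map_smul' := fun _ _ => rfl }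

/-- A weight, as a continuous linear functional. -/
noncomputable def weightCLM (j : Fin r) : (Factors n r × (Fin r → ℝ)) →L[ℝ] ℝ :=
  LinearMap.toContinuousLinearMap
    { toFun := fun z => z.2 j
      map_add' := fun _ _ => rfl
      map_smul' := fun _ _ => rfl }

theorem contDiff_factor_entry (i : Fin k) (a : Fin (n i)) (b : Fin r) :
    ContDiff ℝ ∞ fun z : Factors n r × (Fin r → ℝ) => z.1 i a b :=
  (entryCLM i a b).contDiff

theorem contDiff_weight (j : Fin r) :
    ContDiff ℝ ∞ fun z : Factors n r × (Fin r → ℝ) => z.2 j :=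
  (weightCLM j).contDiff

theorem contDiff_chartPoint {d : ℕ} (hrn : ∀ i, r ≤ n i) (ε : Fin k → Fin r → ℤˣ)
    (e : ChartIndex n r → Fin d) :
    ContDiff ℝ ∞ fun w : Fin d → ℝ => chartPoint hrn ε (w ∘ e) := by
  refine ContDiff.prodMk (f := fun w : Fin d → ℝ => (chartPoint hrn ε (w ∘ e)).1)
    (contDiff_pi.2 fun i => ?_) (contDiff_pi.2 fun j => contDiff_apply ℝ ℝ _)
  exact contDiff_pi.2 fun a => contDiff_pi.2 fun b => (isRegularFun_chartPoint hrn ε e i a b).contDiff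

theorem isOpen_chartDomain (hrn : ∀ i, r ≤ n i) (ε : Fin k → Fin r → ℤˣ) :
    IsOpen (chartDomain hrn ε) := by
  have h : chartDomain hrn ε = (⋂ i, {z : Factors n r × (Fin r → ℝ) |
      (1 + signDiag (ε i) * topBlock (hrn i) (z.1 i)).det ≠ 0}) ∩ ⋂ j, {z | z.2 j ≠ 0} := by
    ext z
    simp [chartDomain]
  rw [h]
  refine (isOpen_iInter_of_finite fun i => ?_).inter (isOpen_iInter_of_finite fun j => ?_)
  · refine isOpen_ne_fun (ContDiff.continuous (𝕜 := ℝ) (n := ∞) ?_) continuous_const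
    refine contDiff_iff_contDiffAt.2 fun z => contDiffAt_det fun a b =>
      ContDiffAt.add contDiffAt_const (contDiffAt_matrix_mul (F := fun _ => signDiag (ε i))
        (fun _ _ => contDiffAt_const) (fun a b => ?_) a b)
    exact (contDiff_factor_entry i _ b).contDiffAt
  · exact isOpen_ne_fun (contDiff_weight j).continuous continuous_const

theorem contDiffAt_chartCoord (hrn : ∀ i, r ≤ n i) (ε : Fin k → Fin r → ℤˣ)
    {z : Factors n r × (Fin r → ℝ)} (hz : z ∈ chartDomain hrn ε) :
    ContDiffAt ℝ ∞ (chartCoord hrn ε) z := by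
  refine contDiffAt_pi.2 fun q => ?_
  have htop : ∀ i a b, ContDiffAt ℝ ∞ (fun z : Factors n r × (Fin r → ℝ) =>
      topBlock (hrn i) (z.1 i) a b) z := fun i a b => (contDiff_factor_entry i _ b).contDiffAt
  have hbot : ∀ i a b, ContDiffAt ℝ ∞ (fun z : Factors n r × (Fin r → ℝ) =>
      botBlock (hrn i) (z.1 i) a b) z := fun i a b => (contDiff_factor_entry i _ b).contDiffAt
  have hcore : ∀ i a b, ContDiffAt ℝ ∞ (fun z : Factors n r × (Fin r → ℝ) =>
      coreOfTop (signDiag (ε i)) (topBlock (hrn i) (z.1 i)) a b) z := fun i a b =>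
    contDiffAt_matrix_mul (F := fun _ => 2) (fun _ _ => contDiffAt_const)
      (contDiffAt_matrix_inv (fun a b => ContDiffAt.add contDiffAt_const
        (contDiffAt_matrix_mul (F := fun _ => signDiag (ε i)) (fun _ _ => contDiffAt_const)
          (htop i) a b)) (hz.1 i)) a b
  have hlow : ∀ i a b, ContDiffAt ℝ ∞ (fun z : Factors n r × (Fin r → ℝ) =>
      lowerOfBlocks (signDiag (ε i)) (topBlock (hrn i) (z.1 i)) (botBlock (hrn i) (z.1 i)) a b) z :=
    fun i a b => ContDiffAt.mul contDiffAt_const (contDiffAt_matrix_mul (hbot i) (hcore i) a b)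
  have hskew : ∀ i a b, ContDiffAt ℝ ∞ (fun z : Factors n r × (Fin r → ℝ) =>
      skewOfBlocks (signDiag (ε i)) (topBlock (hrn i) (z.1 i)) (botBlock (hrn i) (z.1 i)) a b) z :=
    fun i a b => ContDiffAt.sub (ContDiffAt.add contDiffAt_const
      (contDiffAt_matrix_mul (fun a b => hlow i b a) (hlow i) a b)) (hcore i a b)
  rcases q with ⟨i, p | p⟩ | j
  · simp only [chartCoord, Sum.elim_inl]
    exact hskew i p.1.1 p.1.2
  · simp only [chartCoord, Sum.elim_inl, Sum.elim_inr]
    exact hlow i p.1 p.2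
  · simp only [chartCoord, Sum.elim_inr]
    exact (contDiff_weight j).contDiffAt

theorem continuousOn_chartCoord (hrn : ∀ i, r ≤ n i) (ε : Fin k → Fin r → ℤˣ) :
    ContinuousOn (chartCoord hrn ε) (chartDomain hrn ε) := by
  intro z hz
  have h := contDiffAt_chartCoord hrn ε hz
  exact h.continuousAt.continuousWithinAt

/-- The Cayley charts are local parametrizations of the parameter manifold. -/
theorem isLocalParametrization_chartPoint {d : ℕ} (hrn : ∀ i, r ≤ n i) (ε : Fin k → Fin r → ℤˣ)
    (e : ChartIndex n r ≃ Fin d) :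
    IsLocalParametrization (paramManifold n r) {w : Fin d → ℝ | ∀ j, w (e (Sum.inr j)) ≠ 0}
      (fun w => chartPoint hrn ε (w ∘ e)) where
  isOpen_source := by
    simp only [Set.ofPred_forall]
    exact isOpen_iInter_of_finite fun j => isOpen_ne_fun (continuous_apply _) continuous_const
  smooth := (contDiff_chartPoint hrn ε e).contDiffOn
  immersion := by
    intro w hw
    have h1 : DifferentiableAt ℝ (fun w : Fin d → ℝ => chartPoint hrn ε (w ∘ e)) w :=
      ((contDiff_chartPoint hrn ε e).differentiable (by simp)).differentiableAt
    have hw' := chartPoint_mem_chartDomain hrn ε (v := w ∘ e) hw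
    have h2 : DifferentiableAt ℝ (chartCoord hrn ε) (chartPoint hrn ε (w ∘ e)) :=
      (contDiffAt_chartCoord hrn ε hw').differentiableAt (by simp)
    -- The chart coordinates are a differentiable left inverse, so by the chain rule the derivative
    -- of the parametrization is injective.
    have h3 := fderiv_comp w h2 h1
    have h4 : chartCoord hrn ε ∘ (fun w : Fin d → ℝ => chartPoint hrn ε (w ∘ e)) =
        fun w => w ∘ e := funext fun w => chartCoord_chartPoint hrn ε _
    let L : (Fin d → ℝ) →L[ℝ] (ChartIndex n r → ℝ) :=
      ContinuousLinearMap.pi fun q => ContinuousLinearMap.proj (e q)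
    have h5 : fderiv ℝ (fun w : Fin d → ℝ => w ∘ e) w = L := L.hasFDerivAt.fderiv
    rw [h4, h5] at h3
    have h6 : Function.Injective L := fun x y hxy => funext fun t => by
      simpa [L] using congrFun hxy (e.symm t)
    rw [h3] at h6
    exact Function.Injective.of_comp h6
  embedding := by
    have hmem : ∀ w ∈ {w : Fin d → ℝ | ∀ j, w (e (Sum.inr j)) ≠ 0},
        chartPoint hrn ε (w ∘ e) ∈ chartDomain hrn ε := fun w hw =>
      chartPoint_mem_chartDomain hrn ε (v := w ∘ e) hw
    -- A continuous map with a continuous left inverse is an embedding; both are taken with values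
    -- in the open chart domain and its coordinates.
    let f : {w : Fin d → ℝ | ∀ j, w (e (Sum.inr j)) ≠ 0} → chartDomain hrn ε :=
      fun w => ⟨chartPoint hrn ε (w.1 ∘ e), hmem w.1 w.2⟩
    let g : chartDomain hrn ε → {w : Fin d → ℝ | ∀ j, w (e (Sum.inr j)) ≠ 0} :=
      fun z => ⟨chartCoord hrn ε z ∘ e.symm, fun j => by
        simpa [chartCoord] using z.2.2 j⟩
    have hf : Continuous f := ((contDiff_chartPoint hrn ε e).continuous.comp
      continuous_subtype_val).subtype_mk _
    have hg : Continuous g := by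
      refine Continuous.subtype_mk ?_ _
      have h1 : Continuous fun z : chartDomain hrn ε => chartCoord hrn ε z.1 :=
        continuousOn_iff_continuous_domRestrict.1 (continuousOn_chartCoord hrn ε)
      have h2 : Continuous fun v : ChartIndex n r → ℝ => v ∘ e.symm :=
        continuous_pi fun t => continuous_apply _
      exact h2.comp h1
    have hgf : Function.LeftInverse g f := fun w => Subtype.ext <| funext fun t => by
      simp [g, f, chartCoord_chartPoint]
    exact Topology.IsEmbedding.subtypeVal.comp (hgf.isEmbedding hg hf)
  image_eq := by
    refine ⟨chartDomain hrn ε, isOpen_chartDomain hrn ε, ?_⟩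
    ext z
    constructor
    · rintro ⟨w, hw, rfl⟩
      exact ⟨⟨chartPoint_mem_stiefelProd hrn ε _, hw⟩, chartPoint_mem_chartDomain hrn ε (v := w ∘ e) hw⟩
    · rintro ⟨hz, hz'⟩
      refine ⟨chartCoord hrn ε z ∘ e.symm, fun j => ?_, ?_⟩
      · simpa [chartCoord] using hz.2 j
      · have : (chartCoord hrn ε z ∘ e.symm) ∘ e = chartCoord hrn ε z := by
          funext q; simp
        simp only [this]
        exact chartPoint_chartCoord hrn ε hz.1 hz'

/-! ## The objective functions -/

theorem matTensor_diagTensor (U : Factors n r) (x : Fin r → ℝ) (I : ∀ i, Fin (n i)) :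
    matTensor (n := fun _ => r) U (diagTensor k x) I = ∑ j, x j * segre (blockCol U j) I := by
  simp only [matTensor, diagTensor, Finset.mul_sum, segre, blockCol]
  rw [Finset.sum_comm]
  refine Finset.sum_congr rfl fun j _ => ?_
  rw [Finset.sum_eq_single fun _ => j]
  · simp [mul_comm]
  · intro J _ hJ
    rw [if_neg fun h => hJ (funext h), mul_zero]
  · simp

theorem hsInner_segre_segre (x y : ∀ i, Fin (n i) → ℝ) :
    hsInner (segre x) (segre y) = ∏ i, x i ⬝ᵥ y i := by
  simp only [hsInner, segre, dotProduct, Finset.prod_univ_sum, Fintype.piFinset_univ,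
    Finset.prod_mul_distrib]

theorem paramObjective_eq (A : Tensor n) (z : Factors n r × (Fin r → ℝ)) :
    paramObjective A z =
      1 / 2 * ∑ I, (A I - ∑ j, z.2 j * segre (blockCol z.1 j) I) ^ 2 := by
  have h0 : ∀ B : Tensor n, 0 ≤ hsInner B B := fun B =>
    Finset.sum_nonneg fun I _ => mul_self_nonneg _
  rw [paramObjective, hsNorm, Real.sq_sqrt (h0 _)]
  simp only [hsInner, Pi.sub_apply, matTensor_diagTensor, sq]

theorem contDiff_paramObjective (A : Tensor n) :
    ContDiff ℝ ∞ (paramObjective A : Factors n r × (Fin r → ℝ) → ℝ) := by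
  rw [funext fun z => paramObjective_eq A z]
  refine contDiff_const.mul (ContDiff.sum fun I _ => (contDiff_const.sub
    (ContDiff.sum fun j _ => (contDiff_weight j).mul (contDiff_prod fun i _ => ?_))).pow 2)
  exact contDiff_factor_entry i _ j

theorem dotProduct_blockCol {U : Factors n r} (hU : U ∈ stiefelProd n r) (i : Fin k) (j l : Fin r) :
    blockCol U j i ⬝ᵥ blockCol U l i = if j = l then 1 else 0 := by
  have h := congrFun (congrFun (hU i) j) l
  rw [Matrix.one_apply] at h
  exact h

theorem hsInner_segre_blockCol (hk : 0 < k) {U : Factors n r} (hU : U ∈ stiefelProd n r)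
    (j l : Fin r) : hsInner (segre (blockCol U j)) (segre (blockCol U l)) =
      if j = l then 1 else 0 := by
  rw [hsInner_segre_segre]
  simp only [dotProduct_blockCol hU]
  split_ifs
  · simp
  · exact Finset.prod_eq_zero (Finset.mem_univ ⟨0, hk⟩) rfl

/-- Orthonormality of the rank-one tensors reduces the squared norm of the approximant to ∑ x_j²,
and the square is completed at x = λ(U). -/
theorem paramObjective_of_mem (hk : 0 < k) (A : Tensor n) {U : Factors n r}
    (hU : U ∈ stiefelProd n r) (x : Fin r → ℝ) :
    paramObjective A (U, x) = 1 / 2 * hsInner A A - 1 / 2 * objective A U +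
      1 / 2 * ∑ j, (x j - diagValues A U j) ^ 2 := by
  have h1 : ∑ I, A I * ∑ j, x j * segre (blockCol U j) I = ∑ j, x j * diagValues A U j := by
    simp only [diagValues_eq, hsInner, Finset.mul_sum]
    rw [Finset.sum_comm]
    refine Finset.sum_congr rfl fun j _ => Finset.sum_congr rfl fun I _ => ?_
    ring
  have h2 : ∑ I, (∑ j, x j * segre (blockCol U j) I) * (∑ l, x l * segre (blockCol U l) I) =
      ∑ j, x j ^ 2 := by
    have h3 : ∀ j, x j ^ 2 = ∑ l, x j * x l *
        hsInner (segre (blockCol U j)) (segre (blockCol U l)) := by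
      intro j
      simp only [hsInner_segre_blockCol hk hU, mul_ite, mul_one, mul_zero, Finset.sum_ite_eq,
        Finset.mem_univ, if_true, sq]
    simp only [h3, Finset.sum_mul_sum, hsInner]
    simp only [Finset.mul_sum]
    rw [Finset.sum_comm]
    refine Finset.sum_congr rfl fun j _ => ?_
    rw [Finset.sum_comm]
    refine Finset.sum_congr rfl fun l _ => Finset.sum_congr rfl fun I _ => ?_
    ring
  rw [paramObjective_eq]
  have h4 : ∑ I, (A I - ∑ j, x j * segre (blockCol U j) I) ^ 2 = hsInner A A -
      2 * ∑ j, x j * diagValues A U j + ∑ j, x j ^ 2 := by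
    rw [← h1, ← h2, hsInner, Finset.mul_sum, ← Finset.sum_sub_distrib, ← Finset.sum_add_distrib]
    refine Finset.sum_congr rfl fun I _ => ?_
    ring
  have h5 : ∑ j, (x j - diagValues A U j) ^ 2 = ∑ j, x j ^ 2 - 2 * ∑ j, x j * diagValues A U j +
      objective A U := by
    rw [objective, Finset.mul_sum, ← Finset.sum_sub_distrib, ← Finset.sum_add_distrib]
    refine Finset.sum_congr rfl fun j _ => ?_
    ring
  simp only [h4, h5]
  ring

/-- A local maximizer `U` of the objective gives the local minimizer `(U, λ(U))` of `g`. -/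
theorem isLocalMinOn_paramObjective (hk : 0 < k) {A : Tensor n} {U : Factors n r}
    (hU : IsLocalMaximizer A U) :
    IsLocalMinOn (paramObjective A) (paramManifold n r) (U, diagValues A U) := by
  have h1 : Filter.Tendsto Prod.fst (nhdsWithin (U, diagValues A U) (paramManifold n r))
      (nhdsWithin U (stiefelProd n r)) :=
    tendsto_nhdsWithin_iff.2 ⟨continuous_fst.continuousAt.tendsto.mono_left nhdsWithin_le_nhds,
      eventually_nhdsWithin_of_forall fun z hz => hz.1⟩
  have h2 := h1.eventually hU.2
  filter_upwards [h2, self_mem_nhdsWithin] with z hz hzM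
  rw [paramObjective_of_mem hk A hU.1, show z = (z.1, z.2) from rfl,
    paramObjective_of_mem hk A hzM.1]
  have h3 : 0 ≤ ∑ j, (z.2 j - diagValues A z.1 j) ^ 2 := Finset.sum_nonneg fun j _ => sq_nonneg _
  simp only [sub_self]
  norm_num
  linarith

/-! ## Plane rotations and first order conditions -/

theorem contractExcept_update (A : Tensor n) (x : ∀ i, Fin (n i) → ℝ) (i : Fin k)
    (y : Fin (n i) → ℝ) :
    contractExcept A (Function.update x i y) i = contractExcept A x i := by
  funext a
  simp only [contractExcept]
  refine Finset.sum_congr rfl fun I _ => ?_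
  congr 2
  refine Finset.prod_congr rfl fun l hl => ?_
  rw [Function.update_of_ne (Finset.ne_of_mem_erase hl)]

/-- Each λ_j is linear in the j-th column of the i-th factor, and its coefficient vector, the j-th
column of V⁽ⁱ⁾, does not involve that factor. -/
theorem diagValues_update (A : Tensor n) (U : Factors n r) (i : Fin k)
    (B : Matrix (Fin (n i)) (Fin r) ℝ) (j : Fin r) :
    diagValues A (Function.update U i B) j = (matV A U i).col j ⬝ᵥ B.col j := by
  have h : blockCol (Function.update U i B) j = Function.update (blockCol U j) i (B.col j) := by
    funext l a
    by_cases hl : l = i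
    · subst hl; simp [blockCol]
    · simp [blockCol, hl]
  rw [diagValues_eq, ← contractExcept_dotProduct A _ i, h, contractExcept_update,
    Function.update_self]
  rfl

/-- The rotation by the angle `t` in the plane of the orthonormal vectors `a` and `b`. -/
noncomputable def planeRotation {m : ℕ} (a b : Fin m → ℝ) (t : ℝ) : Matrix (Fin m) (Fin m) ℝ :=
  1 + (Real.cos t - 1) • (Matrix.vecMulVec a a + Matrix.vecMulVec b b) +
    Real.sin t • (Matrix.vecMulVec b a - Matrix.vecMulVec a b)

/-- With P the projection onto the plane and K the infinitesimal rotation, PK = KP = K and K² = −P.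
The product becomes 1 plus a multiple of P whose coefficient is zero by sin² + cos² = 1. -/
theorem planeRotation_transpose_mul_self {m : ℕ} {a b : Fin m → ℝ} (ha : a ⬝ᵥ a = 1)
    (hb : b ⬝ᵥ b = 1) (hab : a ⬝ᵥ b = 0) (t : ℝ) :
    (planeRotation a b t).transpose * planeRotation a b t = 1 := by
  have hba : b ⬝ᵥ a = 0 := by rw [dotProduct_comm, hab]
  set P := Matrix.vecMulVec a a + Matrix.vecMulVec b b with hP
  set K := Matrix.vecMulVec b a - Matrix.vecMulVec a b with hK
  have hPt : P.transpose = P := by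
    simp [hP, Matrix.transpose_vecMulVec]
  have hKt : K.transpose = -K := by
    simp [hK, Matrix.transpose_vecMulVec]
  have hPP : P * P = P := by
    simp [hP, Matrix.add_mul, Matrix.mul_add, Matrix.vecMulVec_mul_vecMulVec, ha, hb, hab, hba]
  have hPK : P * K = K := by
    simp [hP, hK, Matrix.add_mul, Matrix.mul_sub, Matrix.vecMulVec_mul_vecMulVec, ha, hb, hab, hba]
  have hKP : K * P = K := by
    simp [hP, hK, Matrix.sub_mul, Matrix.mul_add, Matrix.vecMulVec_mul_vecMulVec, ha, hb, hab, hba]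
    abel
  have hKK : K * K = -P := by
    simp [hP, hK, Matrix.sub_mul, Matrix.mul_sub, Matrix.vecMulVec_mul_vecMulVec, ha, hb, hab, hba]
    abel
  have hR : planeRotation a b t = 1 + (Real.cos t - 1) • P + Real.sin t • K := rfl
  rw [hR, Matrix.transpose_add, Matrix.transpose_add, Matrix.transpose_smul,
    Matrix.transpose_smul, Matrix.transpose_one, hPt, hKt]
  simp only [Matrix.add_mul, Matrix.mul_add, Matrix.one_mul, Matrix.mul_one, Matrix.smul_mul,
    Matrix.mul_smul, hPP, hPK, hKP, hKK, Matrix.neg_mul, smul_neg, neg_neg]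
  have h1 : (Real.cos t - 1) + (Real.cos t - 1) + (Real.cos t - 1) * (Real.cos t - 1) +
      Real.sin t * Real.sin t = 0 := by
    have := Real.sin_sq_add_cos_sq t
    nlinarith
  calc _ = 1 + ((Real.cos t - 1) + (Real.cos t - 1) + (Real.cos t - 1) * (Real.cos t - 1) +
      Real.sin t * Real.sin t) • P := by module
    _ = 1 := by rw [h1, zero_smul, add_zero]

theorem planeRotation_mulVec {m : ℕ} (a b : Fin m → ℝ) (t : ℝ) (v : Fin m → ℝ) :
    (planeRotation a b t).mulVec v = v + (Real.cos t - 1) • ((a ⬝ᵥ v) • a + (b ⬝ᵥ v) • b) +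
      Real.sin t • ((a ⬝ᵥ v) • b - (b ⬝ᵥ v) • a) := by
  simp [planeRotation, Matrix.add_mulVec, Matrix.sub_mulVec, Matrix.smul_mulVec,
    Matrix.vecMulVec_mulVec]

/-- The tuple obtained by rotating the columns of the `i`-th matrix. -/
noncomputable def rotateFactor (U : Factors n r) (i : Fin k) (a b : Fin (n i) → ℝ) (t : ℝ) :
    Factors n r :=
  Function.update U i (planeRotation a b t * U i)

theorem rotateFactor_mem {U : Factors n r} (hU : U ∈ stiefelProd n r) (i : Fin k)
    {a b : Fin (n i) → ℝ} (ha : a ⬝ᵥ a = 1) (hb : b ⬝ᵥ b = 1) (hab : a ⬝ᵥ b = 0) (t : ℝ) :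
    rotateFactor U i a b t ∈ stiefelProd n r := by
  intro l
  by_cases hl : l = i
  · subst hl
    rw [rotateFactor, Function.update_self, Matrix.transpose_mul, Matrix.mul_assoc,
      ← Matrix.mul_assoc _ (planeRotation a b t), planeRotation_transpose_mul_self ha hb hab,
      Matrix.one_mul, hU l]
  · rw [rotateFactor, Function.update_of_ne hl, hU l]

theorem continuous_rotateFactor (U : Factors n r) (i : Fin k) (a b : Fin (n i) → ℝ) :
    Continuous (rotateFactor U i a b) := by
  refine continuous_const.update i (Continuous.matrix_mul ?_ continuous_const)
  unfold planeRotation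
  fun_prop

theorem rotateFactor_zero (U : Factors n r) (i : Fin k) (a b : Fin (n i) → ℝ) :
    rotateFactor U i a b 0 = U := by
  simp [rotateFactor, planeRotation]

theorem col_mul_eq_mulVec {m : ℕ} (R : Matrix (Fin m) (Fin m) ℝ) (B : Matrix (Fin m) (Fin r) ℝ)
    (j : Fin r) : (R * B).col j = R.mulVec (B.col j) := rfl

theorem diagValues_rotateFactor (A : Tensor n) (U : Factors n r) (i : Fin k)
    (a b : Fin (n i) → ℝ) (t : ℝ) (j : Fin r) :
    diagValues A (rotateFactor U i a b t) j = diagValues A U j +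
      (Real.cos t - 1) * ((a ⬝ᵥ (U i).col j) * ((matV A U i).col j ⬝ᵥ a) +
        (b ⬝ᵥ (U i).col j) * ((matV A U i).col j ⬝ᵥ b)) +
      Real.sin t * ((a ⬝ᵥ (U i).col j) * ((matV A U i).col j ⬝ᵥ b) -
        (b ⬝ᵥ (U i).col j) * ((matV A U i).col j ⬝ᵥ a)) := by
  have h := diagValues_update A U i (U i) j
  rw [Function.update_eq_self] at h
  rw [rotateFactor, diagValues_update, col_mul_eq_mulVec, planeRotation_mulVec, h]
  simp only [dotProduct_add, dotProduct_sub, dotProduct_smul, smul_eq_mul]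

/-- The first order condition along plane rotations. -/
theorem sum_diagValues_rotation_eq_zero {A : Tensor n} {U : Factors n r}
    (hU : IsLocalMaximizer A U) (i : Fin k) {a b : Fin (n i) → ℝ} (ha : a ⬝ᵥ a = 1)
    (hb : b ⬝ᵥ b = 1) (hab : a ⬝ᵥ b = 0) :
    ∑ j, diagValues A U j * ((a ⬝ᵥ (U i).col j) * ((matV A U i).col j ⬝ᵥ b) -
      (b ⬝ᵥ (U i).col j) * ((matV A U i).col j ⬝ᵥ a)) = 0 := by
  have hmax : IsLocalMax (fun t => objective A (rotateFactor U i a b t)) 0 := by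
    have h1 : Filter.Tendsto (rotateFactor U i a b) (nhds 0) (nhdsWithin U (stiefelProd n r)) := by
      refine tendsto_nhdsWithin_iff.2 ⟨?_, Filter.Eventually.of_forall fun t =>
        rotateFactor_mem hU.1 i ha hb hab t⟩
      have := (continuous_rotateFactor U i a b).tendsto 0
      rwa [rotateFactor_zero] at this
    have h2 := h1.eventually hU.2
    simpa only [IsLocalMax, IsMaxFilter, rotateFactor_zero] using h2
  -- Here p is the coefficient of cos t − 1 and q that of sin t; only q contributes to the
  -- derivative at t = 0.
  let p : Fin r → ℝ := fun j => (a ⬝ᵥ (U i).col j) * ((matV A U i).col j ⬝ᵥ a) +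
        (b ⬝ᵥ (U i).col j) * ((matV A U i).col j ⬝ᵥ b)
  let q : Fin r → ℝ := fun j => (a ⬝ᵥ (U i).col j) * ((matV A U i).col j ⬝ᵥ b) -
        (b ⬝ᵥ (U i).col j) * ((matV A U i).col j ⬝ᵥ a)
  have hder : HasDerivAt (fun t => objective A (rotateFactor U i a b t))
      (∑ j, 2 * diagValues A U j * q j) 0 := by
    have h1 : ∀ j, HasDerivAt (fun t => diagValues A (rotateFactor U i a b t) j) (q j) 0 := by
      intro j
      simp only [diagValues_rotateFactor]
      have h2 := (((Real.hasDerivAt_cos 0).sub_const 1).mul_const (p j)).const_add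
        (diagValues A U j) |>.fun_add ((Real.hasDerivAt_sin 0).mul_const (q j))
      simpa using h2
    unfold objective
    refine HasDerivAt.fun_sum fun j _ => ?_
    have h2 := (h1 j).fun_pow 2
    simpa [rotateFactor_zero] using h2
  have h0 := hmax.hasDerivAt_eq_zero hder
  have h3 : (2 : ℝ) * ∑ j, diagValues A U j * q j = 0 := by
    rw [← h0, Finset.mul_sum]
    exact Finset.sum_congr rfl fun j _ => by ring
  simpa using h3

theorem matV_mul_matLambda_apply (A : Tensor n) (U : Factors n r) (i : Fin k) (a : Fin (n i))
    (j : Fin r) : (matV A U i * matLambda A U) a j = matV A U i a j * diagValues A U j := by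
  simp [matLambda]

/-- Let G = V⁽ⁱ⁾Λ and U = U⁽ⁱ⁾. Stationarity under rotations in the coordinate planes says that GUᵀ
is symmetric. Hence G = GUᵀU = U(GᵀU), and multiplying by Uᵀ shows that the multiplier P = GᵀU is
symmetric. -/
theorem IsLocalMaximizer.isKKTPoint {A : Tensor n} {U : Factors n r} (hU : IsLocalMaximizer A U) :
    IsKKTPoint A U := by
  have hsymm : ∀ i, (matV A U i * matLambda A U) * (U i).transpose =
      U i * (matV A U i * matLambda A U).transpose := by
    intro i
    ext a b
    by_cases hab : a = b
    · subst hab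
      rw [Matrix.mul_apply, Matrix.mul_apply]
      exact Finset.sum_congr rfl fun j _ => mul_comm _ _
    have h := sum_diagValues_rotation_eq_zero hU i (a := Pi.single a 1) (b := Pi.single b 1)
      (by simp) (by simp) (by simp [Ne.symm hab])
    simp only [single_dotProduct, dotProduct_single, one_mul, mul_one, Matrix.col_apply] at h
    rw [Matrix.mul_apply, Matrix.mul_apply, ← sub_eq_zero, ← Finset.sum_sub_distrib, ← neg_eq_zero,
      ← h, ← Finset.sum_neg_distrib]
    refine Finset.sum_congr rfl fun j _ => ?_
    simp only [Matrix.transpose_apply, matV_mul_matLambda_apply]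
    ring
  refine ⟨hU.1, fun i => (matV A U i * matLambda A U).transpose * U i, fun i => ⟨?_, ?_⟩⟩
  · set G := matV A U i * matLambda A U with hG
    have h1 : G = U i * (G.transpose * U i) := by
      rw [← Matrix.mul_assoc, ← hsymm i, Matrix.mul_assoc, hU.1 i, Matrix.mul_one]
    have h2 : (U i).transpose * G = G.transpose * U i := by
      conv_lhs => rw [h1, ← Matrix.mul_assoc, hU.1 i, Matrix.one_mul]
    rw [Matrix.IsSymm, Matrix.transpose_mul, Matrix.transpose_transpose, h2]
  · rw [← Matrix.mul_assoc, ← hsymm i, Matrix.mul_assoc, hU.1 i, Matrix.mul_one, sub_self]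

/-! ## Immersion of the orthogonal decompositions -/

/-- Rank-one tensors with one factor replaced, as a product with the factor taken out. -/
theorem segre_update (x : ∀ i, Fin (n i) → ℝ) (i : Fin k) (y : Fin (n i) → ℝ)
    (I : ∀ i, Fin (n i)) :
    segre (Function.update x i y) I = (∏ l ∈ Finset.univ.erase i, x l (I l)) * y (I i) := by
  rw [segre, ← Finset.prod_erase_mul _ _ (Finset.mem_univ i), Function.update_self]
  congr 1
  refine Finset.prod_congr rfl fun l hl => ?_
  rw [Function.update_of_ne (Finset.ne_of_mem_erase hl)]

/-- The differential of `(U, x) ↦ ∑_j x_j τ(u_j)` is injective on the tangent space of the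
parameter manifold if `k ≥ 3`. -/
theorem eq_zero_of_differential_eq_zero (hk : 3 ≤ k) {U ξ : Factors n r} {x y : Fin r → ℝ}
    (hU : U ∈ stiefelProd n r) (hx : ∀ j, x j ≠ 0)
    (hξ : ∀ i j, blockCol ξ j i ⬝ᵥ blockCol U j i = 0)
    (h : ∀ I, ∑ j, (y j * segre (blockCol U j) I +
      x j * ∑ i, segre (Function.update (blockCol U j) i (blockCol ξ j i)) I) = 0) :
    ξ = 0 ∧ y = 0 := by
  -- The vanishing tensor is paired with the j₀-th rank-one tensor whose factor in mode i₀ is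
  -- replaced by w.
  have key : ∀ (j₀ : Fin r) (i₀ : Fin k) (w : Fin (n i₀) → ℝ),
      y j₀ * (blockCol U j₀ i₀ ⬝ᵥ w) + x j₀ * (blockCol ξ j₀ i₀ ⬝ᵥ w) = 0 := by
    intro j₀ i₀ w
    set t := Function.update (blockCol U j₀) i₀ w with ht
    have ht0 : t i₀ = w := Function.update_self _ _ _
    have htne : ∀ i, i ≠ i₀ → t i = blockCol U j₀ i := fun i hi => Function.update_of_ne hi _ _
    have h1 : ∑ j, (y j * hsInner (segre (blockCol U j)) (segre t) + x j *
        ∑ i, hsInner (segre (Function.update (blockCol U j) i (blockCol ξ j i))) (segre t)) = 0 := by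
      have h2 : ∑ I, (∑ j, (y j * segre (blockCol U j) I + x j *
          ∑ i, segre (Function.update (blockCol U j) i (blockCol ξ j i)) I)) * segre t I = 0 :=
        Finset.sum_eq_zero fun I _ => by rw [h I, zero_mul]
      rw [← h2]
      simp only [Finset.sum_mul]
      rw [Finset.sum_comm]
      refine Finset.sum_congr rfl fun j _ => ?_
      simp only [add_mul, Finset.sum_add_distrib, hsInner, Finset.mul_sum, Finset.sum_mul]
      congr 1
      · exact Finset.sum_congr rfl fun I _ => by ring
      · rw [Finset.sum_comm]
        exact Finset.sum_congr rfl fun I _ => Finset.sum_congr rfl fun i _ => by ring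
    -- This is where k ≥ 3 enters. A term j ≠ j₀ altered in mode i still has an unaltered mode
    -- different from i and i₀, in which the columns j and j₀ are orthogonal, so it contributes
    -- nothing.
    have hthird : ∀ i : Fin k, ∃ l, l ≠ i ∧ l ≠ i₀ := by
      intro i
      have h3 : ({i, i₀} : Finset (Fin k)).card < Fintype.card (Fin k) :=
        (Finset.card_le_two).trans_lt (by rw [Fintype.card_fin]; omega)
      obtain ⟨l, hl⟩ := Finset.exists_mem_notMem_of_card_lt_card
        (s := ({i, i₀} : Finset (Fin k))) (t := Finset.univ) (by simpa using h3)
      simp only [Finset.mem_insert, Finset.mem_singleton, not_or] at hl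
      exact ⟨l, hl.2.1, hl.2.2⟩
    simp only [hsInner_segre_segre] at h1
    rw [Finset.sum_eq_single j₀] at h1
    · rw [← h1]
      have e1 : ∏ i, blockCol U j₀ i ⬝ᵥ t i = blockCol U j₀ i₀ ⬝ᵥ w := by
        rw [Finset.prod_eq_single i₀, ht0]
        · intro i _ hi
          rw [htne i hi, dotProduct_blockCol hU, if_pos rfl]
        · simp
      have e2 : ∑ i, ∏ l, Function.update (blockCol U j₀) i (blockCol ξ j₀ i) l ⬝ᵥ t l =
          blockCol ξ j₀ i₀ ⬝ᵥ w := by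
        rw [Finset.sum_eq_single i₀, Finset.prod_eq_single i₀, Function.update_self, ht0]
        · intro i _ hi
          rw [Function.update_of_ne hi, htne i hi, dotProduct_blockCol hU, if_pos rfl]
        · simp
        · intro i _ hi
          refine Finset.prod_eq_zero (Finset.mem_univ i) ?_
          rw [Function.update_self, htne i hi, hξ]
        · simp
      rw [e1, e2]
    · intro j _ hj
      have e1 : ∏ i, blockCol U j i ⬝ᵥ t i = 0 := by
        obtain ⟨l, -, hl⟩ := hthird i₀
        refine Finset.prod_eq_zero (Finset.mem_univ l) ?_
        rw [htne l hl, dotProduct_blockCol hU, if_neg hj]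
      have e2 : ∀ i, ∏ l, Function.update (blockCol U j) i (blockCol ξ j i) l ⬝ᵥ t l = 0 := by
        intro i
        obtain ⟨l, hli, hl⟩ := hthird i
        refine Finset.prod_eq_zero (Finset.mem_univ l) ?_
        rw [Function.update_of_ne hli, htne l hl, dotProduct_blockCol hU, if_neg hj]
      simp [e1, e2]
    · simp
  have hy : ∀ j, y j = 0 := by
    intro j
    have h1 := key j ⟨0, by omega⟩ (blockCol U j _)
    rwa [hξ, dotProduct_blockCol hU, if_pos rfl, mul_zero, add_zero, mul_one] at h1
  refine ⟨?_, funext hy⟩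
  funext i
  ext a j
  -- With y = 0, testing against ξ itself leaves x_j |ξ_j|² = 0 in mode i.
  have h1 := key j i (blockCol ξ j i)
  rw [hy j, zero_mul, zero_add] at h1
  have h2 := dotProduct_self_eq_zero.1 ((mul_eq_zero.1 h1).resolve_left (hx j))
  exact congrFun h2 a

/-- The entries of the tensor `∑_j x_j τ(u_j)` in a chart. -/
noncomputable def chartTensor {d : ℕ} (hrn : ∀ i, r ≤ n i) (ε : Fin k → Fin r → ℤˣ)
    (e : ChartIndex n r ≃ Fin d) (I : ∀ i, Fin (n i)) (w : Fin d → ℝ) : ℝ :=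
  ∑ j, (chartPoint hrn ε (w ∘ e)).2 j * segre (blockCol (chartPoint hrn ε (w ∘ e)).1 j) I

theorem isRegularFun_chartTensor {d : ℕ} (hrn : ∀ i, r ≤ n i) (ε : Fin k → Fin r → ℤˣ)
    (e : ChartIndex n r ≃ Fin d) (I : ∀ i, Fin (n i)) :
    IsRegularFun (chartTensor hrn ε e I) :=
  IsRegularFun.sum _ fun _ _ => (IsRegularFun.coord _).mul
    (IsRegularFun.prod _ fun i _ => isRegularFun_chartPoint hrn ε e i _ _)

theorem sum_mul_partialDeriv {d : ℕ} (f : (Fin d → ℝ) → ℝ) (w v : Fin d → ℝ) :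
    ∑ a, v a * partialDeriv a f w = fderiv ℝ f w v := by
  conv_rhs => rw [← Finset.univ_sum_single v, map_sum]
  refine Finset.sum_congr rfl fun a _ => ?_
  rw [partialDeriv, ← smul_eq_mul, ← map_smul]
  congr 1
  rw [← Pi.single_smul, smul_eq_mul, mul_one]

theorem chartTensor_immersion {d : ℕ} (hk : 3 ≤ k) (hrn : ∀ i, r ≤ n i)
    (ε : Fin k → Fin r → ℤˣ) (e : ChartIndex n r ≃ Fin d) {w : Fin d → ℝ}
    (hw : ∀ j, w (e (Sum.inr j)) ≠ 0) (v : Fin d → ℝ)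
    (hv : ∀ I, ∑ a, v a * partialDeriv a (chartTensor hrn ε e I) w = 0) : v = 0 := by
  let ψ : (Fin d → ℝ) → Factors n r × (Fin r → ℝ) := fun w => chartPoint hrn ε (w ∘ e)
  have hψ : HasFDerivAt ψ (fderiv ℝ ψ w) w :=
    ((contDiff_chartPoint hrn ε e).differentiable (by simp)).differentiableAt.hasFDerivAt
  let ζ := fderiv ℝ ψ w v
  have hE : ∀ i a b, HasFDerivAt (fun w => (ψ w).1 i a b)
      ((entryCLM i a b).comp (fderiv ℝ ψ w)) w := fun i a b =>
    (entryCLM i a b).hasFDerivAt.comp w hψ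
  have hX : ∀ j, HasFDerivAt (fun w => (ψ w).2 j)
      ((weightCLM j).comp (fderiv ℝ ψ w)) w := fun j =>
    (weightCLM j).hasFDerivAt.comp w hψ
  have hst : ∀ w, (ψ w).1 ∈ stiefelProd n r := fun w => chartPoint_mem_stiefelProd hrn ε _
  -- Differentiating |u_j|² = 1. Of the tangency conditions to the Stiefel manifold only this
  -- diagonal part is needed.
  have hξ : ∀ i j, blockCol ζ.1 j i ⬝ᵥ blockCol (ψ w).1 j i = 0 := by
    intro i j
    have h1 := HasFDerivAt.fun_sum (u := Finset.univ) fun a (_ : a ∈ Finset.univ) =>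
      (hE i a j).fun_mul (hE i a j)
    have h2 : (fun w => ∑ a, (ψ w).1 i a j * (ψ w).1 i a j) = fun _ => 1 := by
      funext w
      have := dotProduct_blockCol (hst w) i j j
      rwa [if_pos rfl] at this
    rw [h2] at h1
    have h3 := congrArg (fun L => L v) (h1.unique (hasFDerivAt_const _ _))
    simp only [sum_apply, add_apply, smul_apply, smul_eq_mul, zero_apply,
      ContinuousLinearMap.comp_apply] at h3
    have h4 : 2 * (blockCol ζ.1 j i ⬝ᵥ blockCol (ψ w).1 j i) = 0 := by
      rw [← h3, dotProduct, Finset.mul_sum]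
      refine Finset.sum_congr rfl fun a _ => ?_
      change 2 * (ζ.1 i a j * (ψ w).1 i a j) = (ψ w).1 i a j * ζ.1 i a j + (ψ w).1 i a j * ζ.1 i a j
      ring
    linarith
  have hD : ∀ I, ∑ j, (ζ.2 j * segre (blockCol (ψ w).1 j) I + (ψ w).2 j *
      ∑ i, segre (Function.update (blockCol (ψ w).1 j) i (blockCol ζ.1 j i)) I) = 0 := by
    intro I
    have h1 := HasFDerivAt.fun_sum (u := Finset.univ) fun j (_ : j ∈ Finset.univ) =>
      (hX j).fun_mul (HasFDerivAt.finsetProd (u := Finset.univ)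
        fun i (_ : i ∈ Finset.univ) => hE i (I i) j)
    have h2 := hv I
    rw [sum_mul_partialDeriv] at h2
    have h3 : fderiv ℝ (chartTensor hrn ε e I) w = _ := h1.fderiv
    rw [h3] at h2
    rw [← h2]
    simp only [sum_apply, add_apply, smul_apply, smul_eq_mul, ContinuousLinearMap.comp_apply]
    refine Finset.sum_congr rfl fun j _ => ?_
    simp only [segre_update]
    rw [add_comm, mul_comm (ζ.2 j)]
    rfl
  obtain ⟨h1, h2⟩ := eq_zero_of_differential_eq_zero hk (hst w) hw hξ hD
  have hinj := (isLocalParametrization_chartPoint hrn ε e).immersion w hw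
  exact hinj ((Prod.ext h1 h2 : ζ = 0).trans (map_zero (fderiv ℝ ψ w)).symm)

theorem paramObjective_comp_chartPoint {d : ℕ} (hrn : ∀ i, r ≤ n i) (ε : Fin k → Fin r → ℤˣ)
    (e : ChartIndex n r ≃ Fin d) (A : Tensor n) :
    paramObjective A ∘ (fun w : Fin d → ℝ => chartPoint hrn ε (w ∘ e)) =
      fun w => 1 / 2 * ∑ I, (A I - chartTensor hrn ε e I w) ^ 2 :=
  funext fun _ => paramObjective_eq A _

/-! ## Isolatedness of nondegenerate local minimizers -/

/-- At a local minimizer that is a nondegenerate critical point, the minimal value is not attained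
at other nearby points. -/
theorem IsNondegenerateCriticalPoint.eventually_ne {E : Type*} [NormedAddCommGroup E]
    [NormedSpace ℝ E] {M : Set E} {f : E → ℝ} {z : E} (h : IsNondegenerateCriticalPoint M f z)
    (hf : ContDiff ℝ ∞ f) (hmin : IsLocalMinOn f M z) :
    ∀ᶠ z' in nhdsWithin z (M \ {z}), f z' ≠ f z := by
  obtain ⟨d, W, ψ, w₀, hψ, hw₀, rfl, hcrit, hdet⟩ := h
  obtain ⟨O, hO, hWO⟩ := hψ.image_eq
  have hmaps : ∀ w ∈ W, ψ w ∈ M := fun w hw => ((hWO.subset (Set.mem_image_of_mem ψ hw))).1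
  have hsmooth : ContDiffOn ℝ ∞ (f ∘ ψ) W := hf.comp_contDiffOn hψ.smooth
  have hgrad : DifferentiableAt ℝ (fderiv ℝ (f ∘ ψ)) w₀ :=
    ((hsmooth.fderiv_of_isOpen (m := ∞) hψ.isOpen_source (by simp)).contDiffAt
      (hψ.isOpen_source.mem_nhds hw₀)).differentiableAt (by simp)
  -- The Hessian matrix represents the derivative of the gradient. Injectivity in finite dimension
  -- gives a lower bound for it, which keeps the gradient from vanishing at nearby points other than
  -- w₀.
  have hinj : LinearMap.ker (fderiv ℝ (fderiv ℝ (f ∘ ψ)) w₀).toLinearMap = ⊥ := by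
    rw [LinearMap.ker_eq_bot']
    intro v hv
    refine Matrix.eq_zero_of_vecMul_eq_zero hdet (funext fun b => ?_)
    have h1 : ∑ a, v a • fderiv ℝ (fderiv ℝ (f ∘ ψ)) w₀ (Pi.single a 1) = 0 := by
      rw [← hv]
      conv_rhs => rw [← Finset.univ_sum_single v, map_sum]
      refine Finset.sum_congr rfl fun a _ => ?_
      rw [← map_smul, ← Pi.single_smul, smul_eq_mul, mul_one]
      rfl
    have h2 := congrArg (fun L => L (Pi.single b 1)) h1
    simpa [Matrix.vecMul, dotProduct, hessianMatrix, iteratedFDeriv_two_apply] using h2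
  obtain ⟨C, -, hC⟩ := LinearMap.exists_antilipschitzWith _ hinj
  have hev : ∀ᶠ w in nhdsWithin w₀ {w₀}ᶜ, fderiv ℝ (f ∘ ψ) w ≠ 0 :=
    hgrad.hasFDerivAt.eventually_ne ⟨C, hC⟩
  rw [IsLocalMinOn, IsMinFilter, eventually_nhdsWithin_iff, eventually_nhds_iff] at hmin
  obtain ⟨N, hN, hNo, hzN⟩ := hmin
  have hψc : ContinuousOn ψ W := hψ.smooth.continuousOn
  -- A nearby point with the minimal value is itself a local minimizer, hence critical.
  have hWN : ∀ w ∈ W, ψ w ∈ N → f (ψ w) = f (ψ w₀) → fderiv ℝ (f ∘ ψ) w = 0 := by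
    intro w hw hwN hfw
    refine IsLocalMin.fderiv_eq_zero ?_
    have hcont := hψc.continuousAt (hψ.isOpen_source.mem_nhds hw)
    filter_upwards [hψ.isOpen_source.mem_nhds hw, hcont (hNo.mem_nhds hwN)] with w' hw' hw'N
    rw [Function.comp, hfw]
    exact hN _ hw'N (hmaps w' hw')
  have hW₀ : ∀ᶠ w : W in nhds ⟨w₀, hw₀⟩, w.1 ≠ w₀ → fderiv ℝ (f ∘ ψ) w.1 ≠ 0 := by
    rw [eventually_nhdsWithin_iff] at hev
    have hval : Filter.Tendsto (Subtype.val : W → Fin d → ℝ) (nhds ⟨w₀, hw₀⟩) (nhds w₀) :=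
      continuous_subtype_val.continuousAt
    exact hval.eventually hev
  -- The embedding property makes points of M near ψ w₀ correspond to parameters near w₀.
  rw [hψ.embedding.nhds_eq_comap, Filter.eventually_comap] at hW₀
  rw [eventually_nhdsWithin_iff]
  have hzO : ψ w₀ ∈ O := ((hWO.subset (Set.mem_image_of_mem ψ hw₀))).2
  filter_upwards [hW₀, hO.mem_nhds hzO, hNo.mem_nhds hzN] with z' h1 h2 h3 h4 h5
  obtain ⟨w, hw, rfl⟩ := hWO.superset ⟨h4.1, h2⟩
  exact h1 ⟨w, hw⟩ rfl (fun h => h4.2 (congrArg ψ h)) (hWN w hw h3 h5)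

/-! ## Regularity -/

/-- A column fixed by the rotation gives two linear equations for its components along a and b, with
determinant (cos t − 1)² + sin² t > 0, so both components vanish. -/
theorem rotateFactor_ne {U : Factors n r} {i : Fin k} {a b : Fin (n i) → ℝ} (ha : a ⬝ᵥ a = 1)
    (hb : b ⬝ᵥ b = 1) (hab : a ⬝ᵥ b = 0) {j : Fin r} (hj : a ⬝ᵥ (U i).col j ≠ 0) {t : ℝ}
    (ht : Real.cos t ≠ 1) : rotateFactor U i a b t ≠ U := by
  intro h
  have hba : b ⬝ᵥ a = 0 := by rw [dotProduct_comm, hab]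
  have h1 : planeRotation a b t * U i = U i := by
    have := congrFun h i
    rwa [rotateFactor, Function.update_self] at this
  have h2 : (planeRotation a b t).mulVec ((U i).col j) = (U i).col j := by
    rw [← col_mul_eq_mulVec, h1]
  rw [planeRotation_mulVec] at h2
  have h3 := congrArg (fun v => a ⬝ᵥ v) h2
  have h4 := congrArg (fun v => b ⬝ᵥ v) h2
  simp only [dotProduct_add, dotProduct_sub, dotProduct_smul, smul_eq_mul, ha, hb, hab, hba] at h3 h4
  have h5 : ((Real.cos t - 1) ^ 2 + Real.sin t ^ 2) * (a ⬝ᵥ (U i).col j) = 0 := by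
    linear_combination (Real.cos t - 1) * h3 + Real.sin t * h4
  have h6 : 0 < (Real.cos t - 1) ^ 2 := by
    have := sub_ne_zero.2 ht
    positivity
  rcases mul_eq_zero.1 h5 with h7 | h7
  · nlinarith [sq_nonneg (Real.sin t)]
  · exact hj h7

theorem exists_smul_dotProduct_self_eq_one {m : ℕ} {v : Fin m → ℝ} (hv : v ≠ 0) :
    ∃ c : ℝ, c ≠ 0 ∧ (c • v) ⬝ᵥ (c • v) = 1 := by
  have h0 : 0 ≤ v ⬝ᵥ v := Finset.sum_nonneg fun i _ => mul_self_nonneg _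
  have h1 : 0 < v ⬝ᵥ v := h0.lt_of_ne fun h => hv (dotProduct_self_eq_zero.1 h.symm)
  refine ⟨(√(v ⬝ᵥ v))⁻¹, inv_ne_zero (Real.sqrt_pos.2 h1).ne', ?_⟩
  rw [smul_dotProduct, dotProduct_smul, smul_eq_mul, smul_eq_mul, ← mul_assoc, ← mul_inv,
    Real.mul_self_sqrt h0, inv_mul_cancel₀ h1.ne']

theorem finrank_ker_mulVecLin {p q : ℕ} (B : Matrix (Fin p) (Fin q) ℝ) :
    B.rank + Module.finrank ℝ (LinearMap.ker B.mulVecLin) = q := by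
  have := LinearMap.finrank_range_add_finrank_ker B.mulVecLin
  rwa [Module.finrank_fin_fun] at this

theorem exists_mulVec_eq_zero_of_rank_lt {p q : ℕ} {B : Matrix (Fin p) (Fin q) ℝ}
    (h : B.rank < q) : ∃ v, v ≠ 0 ∧ B.mulVec v = 0 := by
  have h1 := finrank_ker_mulVecLin B
  have h2 : LinearMap.ker B.mulVecLin ≠ ⊥ := fun h0 => by
    rw [h0, finrank_bot] at h1
    omega
  obtain ⟨v, hv, hv0⟩ := Submodule.exists_mem_ne_zero_of_ne_bot h2
  exact ⟨v, hv0, hv⟩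

/-- The kernel has dimension at least two, so the functional given by a has a nonzero zero in it. -/
theorem exists_mulVec_eq_zero_orthogonal {p q : ℕ} {B : Matrix (Fin p) (Fin q) ℝ}
    (h : B.rank < q - 1) (a : Fin q → ℝ) : ∃ v, v ≠ 0 ∧ B.mulVec v = 0 ∧ a ⬝ᵥ v = 0 := by
  have h1 := finrank_ker_mulVecLin B
  let L : LinearMap.ker B.mulVecLin →ₗ[ℝ] ℝ :=
    (dotProductBilin ℝ ℝ a).comp (LinearMap.ker B.mulVecLin).subtype
  have h2 : LinearMap.ker L ≠ ⊥ := LinearMap.ker_ne_bot_of_finrank_lt (by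
    rw [Module.finrank_self]
    omega)
  obtain ⟨v, hv, hv0⟩ := Submodule.exists_mem_ne_zero_of_ne_bot h2
  exact ⟨v, fun h0 => hv0 (Subtype.ext h0), v.2, hv⟩

theorem isRegularKKTPoint_of_nondegenerate (hk : 0 < k) {A : Tensor n} {U : Factors n r}
    (hU : IsLocalMaximizer A U) (hne : ∀ j, diagValues A U j ≠ 0)
    (hnd : IsNondegenerateCriticalPoint (paramManifold n r) (paramObjective A)
      (U, diagValues A U)) : IsRegularKKTPoint A U := by
  refine ⟨hU.isKKTPoint, fun i => ?_⟩
  by_contra! hlt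
  obtain ⟨-, P, hP⟩ := hU.isKKTPoint
  obtain ⟨hPs, hG⟩ := hP i
  rw [sub_eq_zero] at hG
  set G := matV A U i * matLambda A U with hGdef
  -- From rank G < r comes a kernel vector q of G. By the KKT equation with symmetric P, the vector
  -- U q lies in the kernel of Gᵀ. From rank G < n_i − 1 comes a second kernel vector of Gᵀ,
  -- orthogonal to it.
  obtain ⟨q, hq0, hq⟩ := exists_mulVec_eq_zero_of_rank_lt (hlt.trans_le (min_le_left _ _))
  have hPq : (P i).mulVec q = 0 := by
    have h1 : P i = (U i).transpose * G := by
      rw [hG, ← Matrix.mul_assoc, hU.1 i, Matrix.one_mul]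
    rw [h1, ← Matrix.mulVec_mulVec, hq, Matrix.mulVec_zero]
  have hUq : (U i).transpose.mulVec ((U i).mulVec q) = q := by
    rw [Matrix.mulVec_mulVec, hU.1 i, Matrix.one_mulVec]
  have hGa : G.transpose.mulVec ((U i).mulVec q) = 0 := by
    rw [hG, Matrix.transpose_mul, ← Matrix.mulVec_mulVec, hUq, hPs, hPq]
  obtain ⟨j, hj⟩ := Function.ne_iff.1 hq0
  have ha0 : (U i).mulVec q ≠ 0 := fun h => hq0 (by rw [← hUq, h, Matrix.mulVec_zero])
  obtain ⟨c, hc0, hc⟩ := exists_smul_dotProduct_self_eq_one ha0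
  obtain ⟨b₀, hb₀, hGb₀, hab₀⟩ := exists_mulVec_eq_zero_orthogonal (B := G.transpose)
    (by rw [Matrix.rank_transpose]; exact hlt.trans_le (min_le_right _ _)) (c • (U i).mulVec q)
  obtain ⟨c', -, hc'⟩ := exists_smul_dotProduct_self_eq_one hb₀
  set a := c • (U i).mulVec q with ha
  set b := c' • b₀ with hb
  have hab : a ⬝ᵥ b = 0 := by rw [hb, dotProduct_smul, hab₀, smul_zero]
  -- Because no λ_l vanishes, the kernel of Gᵀ is orthogonal to the columns of V⁽ⁱ⁾ themselves, so
  -- rotations in the plane of a and b change no λ_l.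
  have hker : ∀ v, G.transpose.mulVec v = 0 → ∀ l, (matV A U i).col l ⬝ᵥ v = 0 := by
    intro v hv l
    have h1 : ∑ x, G x l * v x = 0 := congrFun hv l
    simp only [hGdef, matV_mul_matLambda_apply] at h1
    have h2 : diagValues A U l * ((matV A U i).col l ⬝ᵥ v) = 0 := by
      rw [← h1, dotProduct, Finset.mul_sum]
      refine Finset.sum_congr rfl fun x _ => ?_
      rw [Matrix.col_apply]
      ring
    exact (mul_eq_zero.1 h2).resolve_left (hne l)
  have hVa := hker a (by rw [ha, Matrix.mulVec_smul, hGa, smul_zero])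
  have hVb := hker b (by rw [hb, Matrix.mulVec_smul, hGb₀, smul_zero])
  have haj : a ⬝ᵥ (U i).col j ≠ 0 := by
    have h1 : (U i).mulVec q ⬝ᵥ (U i).col j = q j := by
      rw [dotProduct_comm]
      exact congrFun hUq j
    rw [ha, smul_dotProduct, h1]
    exact mul_ne_zero hc0 hj
  have hconst : ∀ t, diagValues A (rotateFactor U i a b t) = diagValues A U := fun t =>
    funext fun l => by simp [diagValues_rotateFactor, hVa, hVb]
  have hmem := rotateFactor_mem hU.1 i hc hc' hab
  have hval : ∀ t, paramObjective A (rotateFactor U i a b t, diagValues A U) =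
      paramObjective A (U, diagValues A U) := by
    intro t
    rw [paramObjective_of_mem hk A (hmem t), paramObjective_of_mem hk A hU.1, hconst, objective,
      objective, hconst]
  have htend : Filter.Tendsto (fun t => (rotateFactor U i a b t, diagValues A U))
      (nhdsWithin 0 {0}ᶜ)
      (nhdsWithin (U, diagValues A U) (paramManifold n r \ {(U, diagValues A U)})) := by
    refine tendsto_nhdsWithin_iff.2 ⟨?_, ?_⟩
    · have h1 : Continuous fun t => (rotateFactor U i a b t, diagValues A U) :=
        (continuous_rotateFactor U i a b).prodMk continuous_const
      have h2 := h1.tendsto 0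
      rw [rotateFactor_zero] at h2
      exact h2.mono_left nhdsWithin_le_nhds
    -- For 0 < |t| < 2π the cosine differs from 1, so the rotated point really differs from U.
    · have h1 : ∀ᶠ t : ℝ in nhds 0, t ∈ Set.Ioo (-(2 * Real.pi)) (2 * Real.pi) :=
        Ioo_mem_nhds (by linarith [Real.pi_pos]) (by linarith [Real.pi_pos])
      filter_upwards [nhdsWithin_le_nhds h1, self_mem_nhdsWithin] with t ht ht0
      refine ⟨⟨hmem t, hne⟩, fun h => rotateFactor_ne hc hc' hab haj ?_ (congrArg Prod.fst h)⟩
      exact fun h => ht0 ((Real.cos_eq_one_iff_of_lt_of_lt ht.1 ht.2).1 h)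
  have hev := htend.eventually (hnd.eventually_ne (contDiff_paramObjective A)
    (isLocalMinOn_paramObjective hk hU))
  obtain ⟨t, ht⟩ := hev.exists
  exact ht (hval t)

end LROTA

open LROTA

theorem theorem5p3 {k : ℕ} (hk : 3 ≤ k) (n : Fin k → ℕ) (r : ℕ) (hr : 1 ≤ r)
    (hrn : ∀ i, r ≤ n i) :
    Generic fun A : Tensor n =>
      ∀ U : Factors n r, IsLocalMaximizer A U → (∀ j, diagValues A U j ≠ 0) →
        IsNondegenerateCriticalPoint (paramManifold n r) (paramObjective A)
            (U, diagValues A U) ∧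
          IsRegularKKTPoint A U := by
  have hk0 : 0 < k := by omega
  let e : ChartIndex n r ≃ Fin (Fintype.card (ChartIndex n r)) := Fintype.equivFin _
  -- One polynomial per sign pattern, chosen before the tensor; the patterns are finite in number.
  choose G hG0 hG using fun ε : Fin k → Fin r → ℤˣ =>
    exists_polynomial_of_degenerate (isRegularFun_chartTensor hrn ε e)
  refine ⟨∏ ε, G ε, Finset.prod_ne_zero_iff.2 fun ε _ => hG0 ε, fun A hA U hU hne => ?_⟩
  suffices hnd : IsNondegenerateCriticalPoint (paramManifold n r) (paramObjective A)
      (U, diagValues A U) from ⟨hnd, isRegularKKTPoint_of_nondegenerate hk0 hU hne hnd⟩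
  obtain ⟨ε, hε⟩ := exists_mem_chartDomain hrn (U, diagValues A U) hne
  have hpar := isLocalParametrization_chartPoint hrn ε e
  set z : Factors n r × (Fin r → ℝ) := (U, diagValues A U) with hz
  set w : Fin (Fintype.card (ChartIndex n r)) → ℝ := chartCoord hrn ε z ∘ e.symm with hw
  have hwe : w ∘ e = chartCoord hrn ε z := by
    funext q
    simp [hw]
  have hψw : chartPoint hrn ε (w ∘ e) = z := by
    rw [hwe, chartPoint_chartCoord hrn ε hU.1 hε]
  have hwW : ∀ j, w (e (Sum.inr j)) ≠ 0 := by
    intro j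
    have : w (e (Sum.inr j)) = diagValues A U j := congrFun hwe (Sum.inr j)
    rw [this]
    exact hne j
  have hreg := isRegularFun_chartTensor hrn ε e
  have hcomp := paramObjective_comp_chartPoint hrn ε e A
  have hcrit : fderiv ℝ (paramObjective A ∘ fun w => chartPoint hrn ε (w ∘ e)) w = 0 := by
    refine IsLocalMin.fderiv_eq_zero ?_
    have h1 : Filter.Tendsto (fun w => chartPoint hrn ε (w ∘ e)) (nhds w)
        (nhdsWithin z (paramManifold n r)) := by
      refine tendsto_nhdsWithin_iff.2 ⟨?_, ?_⟩
      · have := (contDiff_chartPoint hrn ε e).continuous.tendsto w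
        rwa [hψw] at this
      · filter_upwards [hpar.isOpen_source.mem_nhds hwW] with w' hw'
        exact ⟨chartPoint_mem_stiefelProd hrn ε _, hw'⟩
    have h2 := h1.eventually (isLocalMinOn_paramObjective hk0 hU)
    simpa only [IsLocalMin, IsMinFilter, Function.comp, hψw] using h2
  -- A singular Hessian at this critical point of the chart ε would make the factor `G ε` vanish at
  -- A, contrary to the choice of A.
  refine ⟨_, _, _, w, hpar, hwW, hψw, hcrit, fun hdet => hA ?_⟩
  rw [map_prod]
  refine Finset.prod_eq_zero (Finset.mem_univ ε) (hG ε A w (fun a => ?_)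
    (fun v hv => chartTensor_immersion hk hrn ε e hwW v hv) ?_)
  · have h1 := congrFun (partialDeriv_sqDist (φ := chartTensor hrn ε e)
      (fun I => (hreg I).contDiff.differentiable (by simp)) A a) w
    rw [← hcomp, partialDeriv, hcrit, zero_apply] at h1
    exact neg_eq_zero.1 h1.symm
  · rw [← hdet, hessianMatrix_eq]
    · congr 1
      ext a b
      rw [hcomp]
      exact (partialDeriv_partialDeriv_sqDist hreg A a b w).symm
    · exact (contDiff_paramObjective A).comp (contDiff_chartPoint hrn ε e)
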